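/- **Setting.** Let $x_1,x_2,\dots\in\mathbb R^p$ be a (nonrandom) sequence of covariate vectors, let $\mathbf X=\mathbf X_n$ be the $n\times p$ matrix with rows $x_1^\top,\dots,x_n^\top$, and let $y_i=x_i^\top\beta_0+\epsilon_i$, where $\epsilon_1,\epsilon_2,\dots$ are independent and identically distributed with mean $0$ and variance $\sigma^2<\infty$. Assume that $\frac1n\mathbf X^\top\mathbf X\to\mathbf C$ with $\mathbf C$ positive definite. Order the coordinates so that $\beta_0=(\beta_{10}^\top,\beta_{20}^\top)^\top$, where all components of $\beta_{10}$ are nonzero and $\beta_{20}=0$, and let $\mathbf C_{11}$ be the block of $\mathbf C$ that corresponds to $\beta_{10}$. Let $\beta^{(0)}$ be the ordinary least squares estimator. For a penalty function $p_\lambda$ on $[0,\infty)$, the one-step estimator is $$\widehat\beta=(\widehat\beta_1^\top,\widehat\beta_2^\top)^\top=\arg\min_{\beta\in\mathbb R^p}\ \tfrac12\|\mathbf y-\mathbf X\beta\|^2+n\sum_{j=1}^p p'_\lambda(|\beta^{(0)}_j|)\,|\beta_j| ,$$ where $p'_\lambda(0)$ means $p'_\lambda(0+)$, and a weight $p'_\lambda(|\beta_j^{(0)}|)=+\infty$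 means that $\beta_j=0$ is imposed. The SCAD penalty with parameter $a>2$ is defined by $p_\lambda(0)=0$ and, for $\theta>0$, $p'_\lambda(\theta)=\lambda$ if $\theta\le\lambda$ and $p'_\lambda(\theta)=(a\lambda-\theta)_+/(a-1)$ if $\theta>\lambda$. **Theorem.** Let $p_{\lambda_n}$ be the SCAD penalty, with $a>2$ fixed. If $\sqrt n\,\lambda_n\to\infty$ and $\lambda_n\to0$, then the one-step estimator satisfies: (a) *Sparsity:* $P(\widehat\beta_2=0)\to1$; (b) *Asymptotic normality:* $\sqrt n(\widehat\beta_1-\beta_{10})\to N(0,\sigma^2\mathbf C_{11}^{-1})$ in distribution. In addition, let $p_{\lambda_n}=\lambda_n p$, where $p$ is differentiable on $(0,\infty)$ with $p'$ continuous there, and suppose that for some $s>0$ the derivative $p'(\theta)$ is positive and of exact order $\theta^{-s}$ as $\theta\to0+$, that is, $p'(\theta)=O(\theta^{-s})$ and $p'(\theta)\ge c\,\theta^{-s}$ for some $c>0$ and all sufficiently small $\theta>0$. Then (a) and (b) hold for the one-step estimator if $n^{(1+s)/2}\lambda_n\to\infty$ and $\sqrt n\,\lambda_n\to0$. -/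

import Mathlib

open Filter Topology MeasureTheory ProbabilityTheory Matrix

namespace OneStep

noncomputable section

/-- The `n × p` design matrix whose rows are the first `n` terms of a sequence of covariate
vectors. -/
def design {ι : Type*} (x : ℕ → ι → ℝ) (n : ℕ) : Matrix (Fin n) ι ℝ :=
  Matrix.of fun i j => x i j

/-- The response vector `y = X β₀ + ε` of the linear model with sample size `n`. -/
def response {ι : Type*} [Fintype ι] (x : ℕ → ι → ℝ) (β₀ : ι → ℝ) (e : ℕ → ℝ) (n : ℕ) :
    Fin n → ℝ :=
  fun i => (design x n *ᵥ β₀) i + e i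

/-- The residual sum of squares `‖y - X b‖²`. -/
def rss {ι : Type*} [Fintype ι] {n : ℕ} (X : Matrix (Fin n) ι ℝ) (y : Fin n → ℝ) (b : ι → ℝ) : ℝ :=
  ∑ i, (y i - (X *ᵥ b) i) ^ 2

/-- `b` is an ordinary least squares estimate. -/
def IsOLS {ι : Type*} [Fintype ι] {n : ℕ} (X : Matrix (Fin n) ι ℝ) (y : Fin n → ℝ)
    (b : ι → ℝ) : Prop :=
  ∀ b' : ι → ℝ, rss X y b ≤ rss X y b'

/-- The derivative `p'(θ)` of a penalty function `p` on `[0, ∞)`, where `p'(0)` is read as the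
limit `p'(0+)` of `p'(t)` as `t ↓ 0`, which may be `+∞` (written as a lower limit, so that it is
always meaningful). -/
def penaltyDeriv (p : ℝ → ℝ) (θ : ℝ) : EReal :=
  if 0 < θ then ((deriv p θ : ℝ) : EReal)
  else liminf (fun t : ℝ => ((deriv p t : ℝ) : EReal)) (𝓝[>] (0 : ℝ))

/-- The criterion `½ ‖y - X b‖² + n ∑ⱼ p'(|b⁰ⱼ|) |bⱼ|`. In `EReal` one has `⊤ * 0 = 0`, so an
infinite weight `p'(|b⁰ⱼ|) = +∞` amounts to the constraint `bⱼ = 0`. -/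
def oneStepObjective {ι : Type*} [Fintype ι] {n : ℕ} (p : ℝ → ℝ) (X : Matrix (Fin n) ι ℝ)
    (y : Fin n → ℝ) (b₀ b : ι → ℝ) : EReal :=
  ((1 / 2 * rss X y b : ℝ) : EReal)
    + ((n : ℝ) : EReal) * ∑ j, penaltyDeriv p |b₀ j| * ((|b j| : ℝ) : EReal)

/-- `b` is a one-step (local linear approximation) estimate for the penalty `p`, with initial
estimate `b₀`: a global minimizer of the criterion. -/
def IsOneStep {ι : Type*} [Fintype ι] {n : ℕ} (p : ℝ → ℝ) (X : Matrix (Fin n) ι ℝ)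
    (y : Fin n → ℝ) (b₀ b : ι → ℝ) : Prop :=
  ∀ b' : ι → ℝ, oneStepObjective p X y b₀ b ≤ oneStepObjective p X y b₀ b'

/-- The derivative of the SCAD penalty: `λ` for `θ ≤ λ` and `(aλ - θ)₊ / (a - 1)` for `θ > λ`. -/
def scadDeriv (a lam θ : ℝ) : ℝ :=
  if θ ≤ lam then lam else max (a * lam - θ) 0 / (a - 1)

/-- The SCAD penalty: the function on `[0, ∞)` that vanishes at `0` and has derivative
`scadDeriv a lam`. -/
def scad (a lam θ : ℝ) : ℝ :=
  ∫ t in (0 : ℝ)..θ, scadDeriv a lam t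

/-- The oracle properties: the estimates of the zero coefficients vanish with probability tending
to one, and those of the nonzero coefficients `β₁` satisfy
`√n (b₁ - β₁) → N(0, σ² C₁₁⁻¹)` in distribution. -/
def OracleProperties {Ω : Type*} [MeasurableSpace Ω] (P : Measure Ω) [IsProbabilityMeasure P]
    {q r : ℕ} (C : Matrix (Fin q ⊕ Fin r) (Fin q ⊕ Fin r) ℝ) (σ : ℝ) (β₁ : Fin q → ℝ)
    (b : ℕ → Ω → Fin q ⊕ Fin r → ℝ) : Prop :=
  Tendsto (fun n => P {ω | ∀ j : Fin r, b n ω (Sum.inr j) = 0}) atTop (𝓝 1) ∧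
  TendstoInDistribution
    (fun (n : ℕ) (ω : Ω) =>
      (WithLp.toLp 2 fun j : Fin q => √(n : ℝ) * (b n ω (Sum.inl j) - β₁ j) :
        EuclideanSpace ℝ (Fin q)))
    atTop (id : EuclideanSpace ℝ (Fin q) → EuclideanSpace ℝ (Fin q)) (fun _ => P)
    (multivariateGaussian 0 (σ ^ 2 • C.toBlocks₁₁⁻¹))

theorem continuous_scadDeriv {a lam : ℝ} (ha : 2 < a) (hl : 0 < lam) :
    Continuous (scadDeriv a lam) := by
  unfold scadDeriv
  refine Continuous.if_le continuous_const (by fun_prop) continuous_id continuous_const ?_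
  intro θ hθ
  have h : 0 ≤ a * lam - lam := by nlinarith
  rw [show θ = lam from hθ, max_eq_left h]
  field_simp [show a - 1 ≠ 0 by linarith]

theorem hasDerivAt_scad {a lam : ℝ} (ha : 2 < a) (hl : 0 < lam) (θ : ℝ) :
    HasDerivAt (scad a lam) (scadDeriv a lam θ) θ :=
  intervalIntegral.integral_hasDerivAt_right
    ((continuous_scadDeriv ha hl).intervalIntegrable _ _)
    ((continuous_scadDeriv ha hl).stronglyMeasurableAtFilter _ _)
    (continuous_scadDeriv ha hl).continuousAt

/-- The weights of the one-step SCAD estimate are the values of `scadDeriv`. -/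
theorem penaltyDeriv_scad {a lam : ℝ} (ha : 2 < a) (hl : 0 < lam) {θ : ℝ} (hθ : 0 ≤ θ) :
    penaltyDeriv (scad a lam) θ = ((scadDeriv a lam θ : ℝ) : EReal) := by
  have hd : deriv (scad a lam) = scadDeriv a lam :=
    funext fun t => (hasDerivAt_scad ha hl t).deriv
  unfold penaltyDeriv
  rw [hd]
  split_ifs with h
  · rfl
  · obtain rfl : θ = 0 := le_antisymm (not_lt.mp h) hθ
    refine Tendsto.liminf_eq ?_
    exact (continuous_coe_real_ereal.comp (continuous_scadDeriv ha hl)).continuousAt.tendsto.mono_left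
      nhdsWithin_le_nhds

end

end OneStep

namespace OneStep

theorem ereal_coe_sum {ι : Type*} (s : Finset ι) (f : ι → ℝ) :
    ((∑ i ∈ s, f i : ℝ) : EReal) = ∑ i ∈ s, (f i : EReal) := by
  classical
  induction s using Finset.induction_on with
  | empty => simp
  | insert a s ha ih => rw [Finset.sum_insert ha, Finset.sum_insert ha, EReal.coe_add, ih]

theorem ereal_sum_ne_bot {ι : Type*} (s : Finset ι) (f : ι → EReal) (h : ∀ i ∈ s, f i ≠ ⊥) :
    ∑ i ∈ s, f i ≠ ⊥ := by
  classical
  induction s using Finset.induction_on with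
  | empty => simp
  | insert a s ha ih =>
    rw [Finset.sum_insert ha, Ne, EReal.add_eq_bot_iff, not_or]
    exact ⟨h a (by simp), ih fun i hi => h i (by simp [hi])⟩

theorem ereal_sum_eq_top {ι : Type*} [Fintype ι] (f : ι → EReal) (h : ∀ i, f i ≠ ⊥)
    {j : ι} (hj : f j = ⊤) : ∑ i, f i = ⊤ := by
  classical
  rw [← Finset.add_sum_erase _ _ (Finset.mem_univ j), hj,
    EReal.top_add_of_ne_bot (ereal_sum_ne_bot _ _ fun i _ => h i)]

section Criterion

variable {ι : Type*} [Fintype ι]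

/-- The criterion is real at a vector that vanishes wherever the weight is infinite, and there the
infinite weights may be replaced by any real number. -/
theorem oneStepObjective_eq_coe {n : ℕ} {p : ℝ → ℝ} {X : Matrix (Fin n) ι ℝ}
    {y : Fin n → ℝ} {b₀ b : ι → ℝ} {v : ι → ℝ}
    (hv : ∀ j, penaltyDeriv p |b₀ j| ≠ ⊤ → penaltyDeriv p |b₀ j| = v j)
    (hb : ∀ j, penaltyDeriv p |b₀ j| = ⊤ → b j = 0) :
    oneStepObjective p X y b₀ b = ((1 / 2 * rss X y b + n * ∑ j, v j * |b j| : ℝ) : EReal) := by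
  have h : ∀ j, penaltyDeriv p |b₀ j| * ((|b j| : ℝ) : EReal) = ((v j * |b j| : ℝ) : EReal) := by
    intro j
    by_cases hj : penaltyDeriv p |b₀ j| = ⊤
    · simp [hb j hj]
    · rw [hv j hj, EReal.coe_mul]
  unfold oneStepObjective
  rw [Finset.sum_congr rfl fun j _ => h j, ← ereal_coe_sum, EReal.coe_add, EReal.coe_mul, EReal.coe_mul (n : ℝ)]

theorem IsOneStep.eq_zero_of_top {n : ℕ} (hn : 0 < n) {p : ℝ → ℝ} {X : Matrix (Fin n) ι ℝ}
    {y : Fin n → ℝ} {b₀ b : ι → ℝ} (h : IsOneStep p X y b₀ b)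
    (hbot : ∀ j, penaltyDeriv p |b₀ j| ≠ ⊥) {j : ι} (hj : penaltyDeriv p |b₀ j| = ⊤) :
    b j = 0 := by
  by_contra hne
  have h0 := h 0
  rw [oneStepObjective_eq_coe (v := fun j => (penaltyDeriv p |b₀ j|).toReal)
    (fun j hj => (EReal.coe_toReal hj (hbot j)).symm) (b := 0) (fun _ _ => rfl)] at h0
  have htop : oneStepObjective p X y b₀ b = ⊤ := by
    unfold oneStepObjective
    rw [ereal_sum_eq_top (j := j), EReal.coe_mul_top_of_pos (by exact_mod_cast hn),
      EReal.add_top_of_ne_bot (EReal.coe_ne_bot _)]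
    · intro i
      by_cases hi : penaltyDeriv p |b₀ i| = ⊤
      · rw [hi]
        rcases eq_or_lt_of_le (abs_nonneg (b i)) with h1 | h1
        · simp [← h1]
        · simp [EReal.top_mul_coe_of_pos h1]
      · rw [← EReal.coe_toReal hi (hbot i), ← EReal.coe_mul]
        exact EReal.coe_ne_bot _
    · rw [hj, EReal.top_mul_coe_of_pos (abs_pos.mpr hne)]
  rw [htop] at h0
  exact absurd h0 (not_le.mpr (EReal.coe_lt_top _))

/-- A one-step estimate minimizes a real-valued criterion among the vectors that vanish where the
weight is infinite; infinite weights may be replaced by any real number `K`. -/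
theorem IsOneStep.real_le {n : ℕ} (hn : 0 < n) {p : ℝ → ℝ} {X : Matrix (Fin n) ι ℝ}
    {y : Fin n → ℝ} {b₀ b : ι → ℝ} (h : IsOneStep p X y b₀ b)
    (hbot : ∀ j, penaltyDeriv p |b₀ j| ≠ ⊥) {v : ι → ℝ}
    (hv : ∀ j, penaltyDeriv p |b₀ j| ≠ ⊤ → penaltyDeriv p |b₀ j| = v j)
    {b' : ι → ℝ} (hb' : ∀ j, penaltyDeriv p |b₀ j| = ⊤ → b' j = 0) :
    1 / 2 * rss X y b + n * ∑ j, v j * |b j| ≤ 1 / 2 * rss X y b' + n * ∑ j, v j * |b' j| := by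
  have := h b'
  rwa [oneStepObjective_eq_coe hv fun j hj => h.eq_zero_of_top hn hbot hj,
    oneStepObjective_eq_coe hv hb', EReal.coe_le_coe_iff] at this

/-- The normalized Gram matrix `Xᵀ X / n`. -/
noncomputable def gram (x : ℕ → ι → ℝ) (n : ℕ) : Matrix ι ι ℝ :=
  (n : ℝ)⁻¹ • ((design x n)ᵀ * design x n)

/-- The normalized score `Xᵀ e / √n`. -/
noncomputable def score (x : ℕ → ι → ℝ) (e : ℕ → ℝ) (n : ℕ) : ι → ℝ :=
  (√(n : ℝ))⁻¹ • ((design x n)ᵀ *ᵥ fun i : Fin n => e i)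

/-- The localized least squares criterion `½ uᵀ G u - uᵀ W`. -/
noncomputable def quad (G : Matrix ι ι ℝ) (W u : ι → ℝ) : ℝ :=
  1 / 2 * (u ⬝ᵥ G *ᵥ u) - u ⬝ᵥ W

theorem gram_isSymm {κ : Type*} (x : ℕ → κ → ℝ) (n : ℕ) : (gram x n).IsSymm := by
  simp [gram, Matrix.IsSymm, transpose_smul, transpose_mul]

theorem dotProduct_gram_mulVec (x : ℕ → ι → ℝ) (n : ℕ) (v : ι → ℝ) :
    v ⬝ᵥ gram x n *ᵥ v = (n : ℝ)⁻¹ * ∑ i, ((design x n *ᵥ v) i) ^ 2 := by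
  rw [gram, smul_mulVec, dotProduct_smul, ← mulVec_mulVec, dotProduct_mulVec, vecMul_transpose,
    smul_eq_mul]
  simp [dotProduct, sq]

theorem dotProduct_score (x : ℕ → ι → ℝ) (e : ℕ → ℝ) (n : ℕ) (v : ι → ℝ) :
    v ⬝ᵥ score x e n = (√(n : ℝ))⁻¹ * ∑ i : Fin n, (design x n *ᵥ v) i * e i := by
  rw [score, dotProduct_smul, dotProduct_mulVec, vecMul_transpose, smul_eq_mul]
  rfl

theorem half_rss_response {n : ℕ} (hn : 0 < n) (x : ℕ → ι → ℝ) (β₀ b : ι → ℝ) (e : ℕ → ℝ) :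
    1 / 2 * rss (design x n) (response x β₀ e n) b
      = 1 / 2 * ∑ i : Fin n, e i ^ 2
        + quad (gram x n) (score x e n) (√(n : ℝ) • (b - β₀)) := by
  have hn' : (0 : ℝ) < n := by exact_mod_cast hn
  have hs : √(n : ℝ) ≠ 0 := (Real.sqrt_pos.mpr hn').ne'
  have hss : √(n : ℝ) * √(n : ℝ) = n := Real.mul_self_sqrt hn'.le
  rw [quad, dotProduct_gram_mulVec, dotProduct_score]
  simp only [mulVec_smul, Pi.smul_apply, smul_eq_mul, mul_pow, Real.sq_sqrt hn'.le,
    ← Finset.mul_sum, mul_assoc]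
  rw [inv_mul_cancel_left₀ hn'.ne', inv_mul_cancel_left₀ hs]
  simp only [rss, response, mulVec_sub, Pi.sub_apply, Finset.mul_sum, ← Finset.sum_add_distrib,
    ← Finset.sum_sub_distrib]
  refine Finset.sum_congr rfl fun i _ => ?_
  ring

theorem quad_add {G : Matrix ι ι ℝ} (hG : G.IsSymm) (W u d : ι → ℝ) :
    quad G W (u + d) = quad G W u + d ⬝ᵥ (G *ᵥ u - W) + 1 / 2 * (d ⬝ᵥ G *ᵥ d) := by
  have h : u ⬝ᵥ G *ᵥ d = d ⬝ᵥ G *ᵥ u := by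
    rw [dotProduct_mulVec, ← mulVec_transpose, hG.eq, dotProduct_comm]
  simp only [quad, mulVec_add, dotProduct_add, add_dotProduct, dotProduct_sub, h]
  ring

theorem abs_dotProduct_le (u W : ι → ℝ) {M : ℝ} (hW : ∀ j, |W j| ≤ M) :
    |u ⬝ᵥ W| ≤ M * ∑ j, |u j| := by
  rw [dotProduct, Finset.mul_sum]
  refine (Finset.abs_sum_le_sum_abs _ _).trans (Finset.sum_le_sum fun j _ => ?_)
  rw [abs_mul, mul_comm]
  exact mul_le_mul_of_nonneg_right (hW j) (abs_nonneg _)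

theorem abs_mulVec_le {κ : Type*} {A : Matrix κ ι ℝ} {u : ι → ℝ} {g R : ℝ}
    (hA : ∀ i j, |A i j| ≤ g) (hu : ∀ j, |u j| ≤ R) (i : κ) :
    |(A *ᵥ u) i| ≤ Fintype.card ι * (g * R) := by
  rw [mulVec, dotProduct]
  refine (Finset.abs_sum_le_sum_abs _ _).trans ?_
  refine (Finset.sum_le_card_nsmul Finset.univ _ (g * R) fun j _ => ?_).trans ?_
  · rw [abs_mul]
    exact mul_le_mul (hA i j) (hu j) (abs_nonneg _) ((abs_nonneg _).trans (hA i j))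
  · simp [Finset.card_univ]

/-- A sublevel bound for the localized criterion bounds every coordinate. -/
theorem abs_le_of_quad_le {G : Matrix ι ι ℝ} {W u : ι → ℝ} {κ M δ : ℝ} (hκ : 0 < κ)
    (hG : κ * ∑ j, u j ^ 2 ≤ u ⬝ᵥ G *ᵥ u) (hW : ∀ j, |W j| ≤ M) (hM : 0 ≤ M) (hδ : 0 ≤ δ)
    (h : quad G W u ≤ δ * ∑ j, |u j|) (j : ι) :
    |u j| ≤ √(Fintype.card ι) * (2 * (M + δ) / κ) := by
  have h1 : κ / 2 * ∑ j, u j ^ 2 ≤ (M + δ) * ∑ j, |u j| := by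
    have := (abs_le.mp (abs_dotProduct_le u W hW)).2
    unfold quad at h
    linarith
  have h2 : (M + δ) * ∑ j, |u j|
      ≤ κ / 4 * ∑ j, u j ^ 2 + Fintype.card ι * ((M + δ) ^ 2 / κ) := by
    rw [Finset.mul_sum, Finset.mul_sum]
    have : (Fintype.card ι : ℝ) * ((M + δ) ^ 2 / κ) = ∑ _j : ι, (M + δ) ^ 2 / κ := by simp
    rw [this, ← Finset.sum_add_distrib]
    refine Finset.sum_le_sum fun j _ => ?_
    have h3 : κ / 4 * u j ^ 2 + (M + δ) ^ 2 / κ - (M + δ) * |u j|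
        = (κ * |u j| / 2 - (M + δ)) ^ 2 / κ := by
      rw [← sq_abs (u j)]
      field_simp
      ring
    have h4 : 0 ≤ (κ * |u j| / 2 - (M + δ)) ^ 2 / κ := by positivity
    linarith
  have h5 : u j ^ 2 ≤ ∑ j, u j ^ 2 :=
    Finset.single_le_sum (f := fun j => u j ^ 2) (fun i _ => sq_nonneg _) (Finset.mem_univ j)
  refine abs_le_of_sq_le_sq ?_ (by positivity)
  rw [mul_pow, Real.sq_sqrt (Nat.cast_nonneg _)]
  refine h5.trans ?_
  have h6 : κ / 4 * ∑ j, u j ^ 2 ≤ Fintype.card ι * ((M + δ) ^ 2 / κ) := by linarith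
  calc ∑ j, u j ^ 2 = 4 / κ * (κ / 4 * ∑ j, u j ^ 2) := by field_simp
    _ ≤ 4 / κ * (Fintype.card ι * ((M + δ) ^ 2 / κ)) := by gcongr
    _ = Fintype.card ι * (2 * (M + δ) / κ) ^ 2 := by field_simp; ring

end Criterion

/-- The localized one-step criterion, in terms of `u = √n (b - β₀)`. -/
noncomputable def localCriterion {ι : Type*} [Fintype ι] (G : Matrix ι ι ℝ) (W B w u : ι → ℝ) : ℝ :=
  quad G W u + ∑ j, w j * |B j + u j|

theorem half_rss_add_penalty {ι : Type*} [Fintype ι] {n : ℕ} (hn : 0 < n) (x : ℕ → ι → ℝ)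
    (β₀ b v : ι → ℝ) (e : ℕ → ℝ) :
    1 / 2 * rss (design x n) (response x β₀ e n) b + n * ∑ j, v j * |b j|
      = 1 / 2 * ∑ i : Fin n, e i ^ 2
        + localCriterion (gram x n) (score x e n) (√(n : ℝ) • β₀) (√(n : ℝ) • v)
          (√(n : ℝ) • (b - β₀)) := by
  rw [half_rss_response hn, localCriterion, Finset.mul_sum _ _ (n : ℝ), add_assoc]
  congr 2
  refine Finset.sum_congr rfl fun j _ => ?_
  have h : √(n : ℝ) * √(n : ℝ) = n := Real.mul_self_sqrt (Nat.cast_nonneg _)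
  simp only [Pi.smul_apply, Pi.sub_apply, smul_eq_mul]
  rw [← mul_add, add_sub_cancel, abs_mul, abs_of_nonneg (Real.sqrt_nonneg _)]
  nth_rewrite 1 [← h]
  ring

section Comparison

variable {α γ : Type*} [Fintype α] [Fintype γ]

theorem quad_le_of_localCriterion_le {G : Matrix (α ⊕ γ) (α ⊕ γ) ℝ} {W B w u : α ⊕ γ → ℝ} {δ : ℝ}
    (hB : ∀ j, B (Sum.inr j) = 0) (hl : ∀ j, |w (Sum.inl j)| ≤ δ) (hδ : 0 ≤ δ)
    (hr : ∀ j, 0 ≤ w (Sum.inr j))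
    (h : localCriterion G W B w u ≤ localCriterion G W B w 0) :
    quad G W u ≤ δ * ∑ j, |u j| := by
  unfold localCriterion at h
  have h0 : quad G W 0 = 0 := by simp [quad]
  have h1 : ∑ j, w j * |B j + (0 : α ⊕ γ → ℝ) j| - ∑ j, w j * |B j + u j| ≤ δ * ∑ j, |u j| := by
    rw [← Finset.sum_sub_distrib, Finset.mul_sum]
    refine Finset.sum_le_sum fun j _ => ?_
    rcases j with j | j
    · rw [← mul_sub]
      refine (le_abs_self _).trans ?_
      rw [abs_mul]
      refine mul_le_mul (hl j) ?_ (abs_nonneg _) hδ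
      refine (abs_abs_sub_abs_le _ _).trans ?_
      simp
    · have := mul_nonneg (hr j) (abs_nonneg (u (Sum.inr j)))
      have := mul_nonneg hδ (abs_nonneg (u (Sum.inr j)))
      simp only [hB, Pi.zero_apply, add_zero, abs_zero, mul_zero, zero_add, zero_sub]
      linarith
  linarith

theorem inr_eq_zero_of_localCriterion_le {G : Matrix (α ⊕ γ) (α ⊕ γ) ℝ} (hG : G.IsSymm)
    {W B w u : α ⊕ γ → ℝ} {g R M : ℝ} (hpos : ∀ v, 0 ≤ v ⬝ᵥ G *ᵥ v) (hg : ∀ i j, |G i j| ≤ g)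
    (hW : ∀ j, |W j| ≤ M) (hu : ∀ j, |u j| ≤ R) (hB : ∀ j, B (Sum.inr j) = 0)
    (hw : ∀ j, Fintype.card (α ⊕ γ) * (g * R) + M < w (Sum.inr j))
    (h : localCriterion G W B w u ≤ localCriterion G W B w (Sum.elim (fun j => u (Sum.inl j)) 0))
    (j : γ) : u (Sum.inr j) = 0 := by
  set u' : α ⊕ γ → ℝ := Sum.elim (fun j => u (Sum.inl j)) 0 with hu'
  set d : α ⊕ γ → ℝ := Sum.elim 0 (fun j => u (Sum.inr j)) with hd
  set A := Fintype.card (α ⊕ γ) * (g * R) + M with hA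
  have hud : u = u' + d := by
    ext j
    rcases j with j | j <;> simp [hu', hd]
  have hu'R : ∀ j, |u' j| ≤ R := by
    intro j
    rcases j with j | j
    · exact hu _
    · simpa [hu'] using (abs_nonneg _).trans (hu (Sum.inr j))
  have hA' : ∀ j, |(G *ᵥ u' - W) j| ≤ A := fun j =>
    (abs_sub _ _).trans (add_le_add (abs_mulVec_le hg hu'R j) (hW j))
  have h1 := (abs_le.mp (abs_dotProduct_le d _ hA')).1
  have h2 := hpos d
  have h3 : quad G W u = quad G W u' + d ⬝ᵥ (G *ᵥ u' - W) + 1 / 2 * (d ⬝ᵥ G *ᵥ d) := by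
    conv_lhs => rw [hud]
    exact quad_add hG W u' d
  have h4 : ∑ j, |d j| = ∑ j : γ, |u (Sum.inr j)| := by
    simp [Fintype.sum_sum_type, hd]
  have h5 : ∑ j, (w (Sum.inr j) - A) * |u (Sum.inr j)| ≤ 0 := by
    simp only [localCriterion, Fintype.sum_sum_type, hB] at h
    simp only [sub_mul, Finset.sum_sub_distrib, ← Finset.mul_sum]
    simp only [hu', Sum.elim_inl, Sum.elim_inr, Pi.zero_apply, add_zero, abs_zero, mul_zero,
      Finset.sum_const_zero, zero_add] at h
    rw [h4] at h1
    linarith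
  have h6 := (Finset.sum_eq_zero_iff_of_nonneg fun j _ =>
    mul_nonneg (sub_pos.mpr (hw j)).le (abs_nonneg (u (Sum.inr j)))).mp
    (le_antisymm h5 (Finset.sum_nonneg fun j _ =>
      mul_nonneg (sub_pos.mpr (hw j)).le (abs_nonneg (u (Sum.inr j))))) j (Finset.mem_univ j)
  exact abs_eq_zero.mp ((mul_eq_zero.mp h6).resolve_left (sub_pos.mpr (hw j)).ne')

end Comparison

theorem abs_le_of_forall_quadratic {a c δ : ℝ}
    (h : ∀ t : ℝ, 0 ≤ t * a + c * t ^ 2 + δ * |t|) : |a| ≤ δ := by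
  have key : ∀ a : ℝ, (∀ t : ℝ, 0 < t → 0 ≤ t * a + c * t ^ 2 + δ * t) → -a ≤ δ := by
    intro a h
    by_contra hlt
    push Not at hlt
    have hη : 0 < -a - δ := by linarith
    have ht : 0 < (-a - δ) / (2 * (|c| + 1)) := by positivity
    have h1 := h _ ht
    set t := (-a - δ) / (2 * (|c| + 1)) with htdef
    have h2 : (|c| + 1) * t = (-a - δ) / 2 := by rw [htdef]; field_simp
    have h3 : 0 ≤ a + c * t + δ := by
      have : 0 ≤ t * (a + c * t + δ) := by linarith [h1, mul_comm t δ, sq t, mul_comm c t]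
      exact nonneg_of_mul_nonneg_right (by linarith) ht
    have h4 : c * t ≤ (|c| + 1) * t := mul_le_mul_of_nonneg_right (by linarith [le_abs_self c]) ht.le
    linarith
  refine abs_le.mpr ⟨?_, ?_⟩
  · have := key a fun t ht => by simpa [abs_of_pos ht] using h t
    linarith
  · have := key (-a) fun t ht => by simpa [abs_of_pos ht] using h (-t)
    linarith

theorem abs_gradient_le_of_localCriterion_le {ι : Type*} [Fintype ι] [DecidableEq ι]
    {G : Matrix ι ι ℝ} (hG : G.IsSymm) {W B w u : ι → ℝ} {δ : ℝ} {j : ι} (hw : |w j| ≤ δ)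
    (h : ∀ t, localCriterion G W B w u ≤ localCriterion G W B w (u + Pi.single j t)) :
    |(G *ᵥ u - W) j| ≤ δ := by
  refine abs_le_of_forall_quadratic (c := 1 / 2 * G j j) fun t => ?_
  have h1 := h t
  simp only [localCriterion, quad_add hG] at h1
  have h2 : ∑ i, w i * |B i + (u + Pi.single j t : ι → ℝ) i| - ∑ i, w i * |B i + u i| ≤ δ * |t| := by
    rw [← Finset.sum_sub_distrib, Finset.sum_eq_single j]
    · rw [← mul_sub]
      refine (le_abs_self _).trans ?_
      rw [abs_mul]
      refine mul_le_mul hw ?_ (abs_nonneg _) ((abs_nonneg _).trans hw)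
      refine (abs_abs_sub_abs_le _ _).trans ?_
      simp [← add_assoc]
    · intro i _ hi
      simp [hi]
    · simp
  have h3 : Pi.single j t ⬝ᵥ G *ᵥ Pi.single j t = G j j * t ^ 2 := by
    simp
    ring
  rw [h3, single_dotProduct] at h1
  linarith

/-- Quadratic forms near a positive definite matrix are uniformly bounded below. -/
theorem eventually_sum_sq_le_quadForm {ι κ : Type*} [Fintype ι] {l : Filter κ}
    {G : κ → Matrix ι ι ℝ} {C : Matrix ι ι ℝ} (hC : C.PosDef) (hG : Tendsto G l (𝓝 C)) :
    ∃ c : ℝ, 0 < c ∧ ∀ᶠ n in l, ∀ u : ι → ℝ, c * ∑ j, u j ^ 2 ≤ u ⬝ᵥ G n *ᵥ u := by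
  obtain ⟨m, hm, hCm⟩ : ∃ m : ℝ, 0 < m ∧ ∀ u : ι → ℝ, m * ‖u‖ ^ 2 ≤ u ⬝ᵥ C *ᵥ u := by
    rcases (Metric.sphere (0 : ι → ℝ) 1).eq_empty_or_nonempty with he | hne
    · refine ⟨1, one_pos, fun u => ?_⟩
      have : u = 0 := by
        by_contra hu
        have : ‖u‖⁻¹ • u ∈ Metric.sphere (0 : ι → ℝ) 1 := by
          simp [norm_smul, hu]
        rw [he] at this
        exact this
      simp [this]
    · obtain ⟨u₀, hu₀, hmin⟩ := (isCompact_sphere (0 : ι → ℝ) 1).exists_isMinOn hne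
        (f := fun u : ι → ℝ => u ⬝ᵥ C *ᵥ u) (by fun_prop)
      have hu₀' : u₀ ≠ 0 := by
        rintro rfl
        simp at hu₀
      refine ⟨u₀ ⬝ᵥ C *ᵥ u₀, by simpa using hC.dotProduct_mulVec_pos hu₀', fun u => ?_⟩
      rcases eq_or_ne u 0 with rfl | hu
      · simp
      · have hs : ‖u‖⁻¹ • u ∈ Metric.sphere (0 : ι → ℝ) 1 := by
          simp [norm_smul, hu]
        have h1 : u₀ ⬝ᵥ C *ᵥ u₀ ≤ (‖u‖⁻¹ • u) ⬝ᵥ C *ᵥ (‖u‖⁻¹ • u) := hmin hs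
        rw [mulVec_smul, smul_dotProduct, dotProduct_smul, smul_eq_mul, smul_eq_mul] at h1
        have hpos : 0 < ‖u‖ := norm_pos_iff.mpr hu
        calc u₀ ⬝ᵥ C *ᵥ u₀ * ‖u‖ ^ 2
            ≤ (‖u‖⁻¹ * (‖u‖⁻¹ * (u ⬝ᵥ C *ᵥ u))) * ‖u‖ ^ 2 := by gcongr
          _ = u ⬝ᵥ C *ᵥ u := by field_simp
  set N : ℝ := (Fintype.card ι : ℝ) with hN
  have hη : 0 < m / (2 * (N ^ 2 + 1)) := by positivity
  refine ⟨m / (2 * (N + 1)), by positivity, ?_⟩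
  have hent : ∀ᶠ n in l, ∀ i j, |(G n - C) i j| ≤ m / (2 * (N ^ 2 + 1)) := by
    refine eventually_all.mpr fun i => eventually_all.mpr fun j => ?_
    have h1 : Tendsto (fun n => (G n - C) i j) l (𝓝 0) := by
      simpa using ((tendsto_pi_nhds.mp (tendsto_pi_nhds.mp hG i) j).sub_const (C i j))
    have h2 := h1.abs
    rw [abs_zero] at h2
    exact h2.eventually_le_const hη
  filter_upwards [hent] with n hn u
  have h1 : |u ⬝ᵥ (G n - C) *ᵥ u| ≤ m / 2 * ‖u‖ ^ 2 := by
    refine (abs_dotProduct_le u _ (abs_mulVec_le hn fun j => norm_le_pi_norm u j)).trans ?_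
    have : ∑ j, |u j| ≤ N * ‖u‖ := by
      refine (Finset.sum_le_card_nsmul Finset.univ _ ‖u‖ fun j _ => norm_le_pi_norm u j).trans ?_
      simp [Finset.card_univ, hN]
    calc N * (m / (2 * (N ^ 2 + 1)) * ‖u‖) * ∑ j, |u j|
        ≤ N * (m / (2 * (N ^ 2 + 1)) * ‖u‖) * (N * ‖u‖) := by gcongr
      _ = m / 2 * ‖u‖ ^ 2 * (N ^ 2 / (N ^ 2 + 1)) := by field_simp
      _ ≤ m / 2 * ‖u‖ ^ 2 * 1 := by
        gcongr
        rw [div_le_one (by positivity)]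
        linarith
      _ = _ := mul_one _
  have h2 : ∑ j, u j ^ 2 ≤ N * ‖u‖ ^ 2 := by
    refine (Finset.sum_le_card_nsmul Finset.univ _ (‖u‖ ^ 2) fun j _ => ?_).trans ?_
    · rw [← sq_abs]
      exact pow_le_pow_left₀ (abs_nonneg _) (norm_le_pi_norm u j) 2
    · simp [Finset.card_univ, hN]
  have h3 : u ⬝ᵥ G n *ᵥ u = u ⬝ᵥ C *ᵥ u + u ⬝ᵥ (G n - C) *ᵥ u := by
    rw [sub_mulVec, dotProduct_sub]
    ring
  have h4 : m / (2 * (N + 1)) * ∑ j, u j ^ 2 ≤ m / 2 * ‖u‖ ^ 2 := by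
    calc m / (2 * (N + 1)) * ∑ j, u j ^ 2 ≤ m / (2 * (N + 1)) * (N * ‖u‖ ^ 2) := by gcongr
      _ = m / 2 * ‖u‖ ^ 2 * (N / (N + 1)) := by field_simp
      _ ≤ m / 2 * ‖u‖ ^ 2 * 1 := by
        gcongr
        rw [div_le_one (by positivity)]
        linarith
      _ = _ := mul_one _
  have h5 := (abs_le.mp h1).1
  have h6 := hCm u
  linarith

theorem IsOLS.quad_nonpos {ι : Type*} [Fintype ι] {n : ℕ} (hn : 0 < n) {x : ℕ → ι → ℝ}
    {β₀ b : ι → ℝ} {e : ℕ → ℝ} (h : IsOLS (design x n) (response x β₀ e n) b) :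
    quad (gram x n) (score x e n) (√(n : ℝ) • (b - β₀)) ≤ 0 := by
  have h1 := h β₀
  have h2 := half_rss_response hn x β₀ b e
  have h3 := half_rss_response hn x β₀ β₀ e
  have h4 : quad (gram x n) (score x e n) (√(n : ℝ) • (β₀ - β₀)) = 0 := by simp [quad]
  linarith

/-- The deterministic part of the oracle property at a fixed sample size. -/
theorem IsOneStep.oracle {α γ : Type*} [Fintype α] [Fintype γ] {n : ℕ} (hn : 0 < n)
    {x : ℕ → α ⊕ γ → ℝ} {β₀ b₀ b : α ⊕ γ → ℝ} {e : ℕ → ℝ} {p : ℝ → ℝ}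
    {κ g M δ R : ℝ} (hκ : 0 < κ) (hM : 0 ≤ M) (hδ : 0 ≤ δ)
    (hR : √(Fintype.card (α ⊕ γ)) * (2 * (M + δ) / κ) ≤ R)
    (hG : ∀ u : α ⊕ γ → ℝ, κ * ∑ j, u j ^ 2 ≤ u ⬝ᵥ gram x n *ᵥ u)
    (hg : ∀ i j, |gram x n i j| ≤ g) (hW : ∀ j, |score x e n j| ≤ M)
    (hβ : ∀ j, β₀ (Sum.inr j) = 0)
    (hl : ∀ j, ∃ v : ℝ, penaltyDeriv p |b₀ (Sum.inl j)| = v ∧ √(n : ℝ) * |v| ≤ δ)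
    {K : ℝ} (hK : Fintype.card (α ⊕ γ) * (g * R) + M < K) (hK0 : 0 ≤ K)
    (hr : ∀ j, ((K / √(n : ℝ) : ℝ) : EReal) ≤ penaltyDeriv p |b₀ (Sum.inr j)|)
    (h : IsOneStep p (design x n) (response x β₀ e n) b₀ b) :
    (∀ j, b (Sum.inr j) = 0) ∧ (∀ j, |√(n : ℝ) * (b j - β₀ j)| ≤ R) ∧
      ∀ j, |(gram x n *ᵥ (√(n : ℝ) • (b - β₀)) - score x e n) (Sum.inl j)| ≤ δ := by
  classical
  have hsn : 0 < √(n : ℝ) := Real.sqrt_pos.mpr (by exact_mod_cast hn)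
  have hbot : ∀ j, penaltyDeriv p |b₀ j| ≠ ⊥ := by
    rintro (j | j)
    · obtain ⟨v, hv, -⟩ := hl j
      rw [hv]
      exact EReal.coe_ne_bot _
    · exact ((EReal.bot_lt_coe _).trans_le (hr j)).ne'
  set v : α ⊕ γ → ℝ := fun j =>
    if penaltyDeriv p |b₀ j| = ⊤ then K / √(n : ℝ) else (penaltyDeriv p |b₀ j|).toReal with hvdef
  have hv : ∀ j, penaltyDeriv p |b₀ j| ≠ ⊤ → penaltyDeriv p |b₀ j| = v j := by
    intro j hj
    simp only [hvdef, if_neg hj]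
    exact (EReal.coe_toReal hj (hbot j)).symm
  have hfin : ∀ j, penaltyDeriv p |b₀ (Sum.inl j)| ≠ ⊤ := by
    intro j
    obtain ⟨w, hw, -⟩ := hl j
    rw [hw]
    exact EReal.coe_ne_top _
  have hvl : ∀ j, |(√(n : ℝ) • v) (Sum.inl j)| ≤ δ := by
    intro j
    obtain ⟨w, hw, hwδ⟩ := hl j
    have h1 : v (Sum.inl j) = w := by
      have := hv _ (hfin j)
      rw [hw] at this
      exact_mod_cast this.symm
    rwa [Pi.smul_apply, smul_eq_mul, abs_mul, abs_of_pos hsn, h1]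
  have hvr : ∀ j, K ≤ (√(n : ℝ) • v) (Sum.inr j) := by
    intro j
    have h1 : K / √(n : ℝ) ≤ v (Sum.inr j) := by
      by_cases hj : penaltyDeriv p |b₀ (Sum.inr j)| = ⊤
      · simp [hvdef, if_pos hj]
      · have := hr j
        rw [hv _ hj] at this
        exact_mod_cast this
    rw [div_le_iff₀ hsn] at h1
    rwa [Pi.smul_apply, smul_eq_mul, mul_comm]
  have hB : ∀ j, (√(n : ℝ) • β₀) (Sum.inr j) = 0 := fun j => by simp [hβ]
  have hmin : ∀ b' : α ⊕ γ → ℝ, (∀ j, penaltyDeriv p |b₀ j| = ⊤ → b' j = 0) →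
      localCriterion (gram x n) (score x e n) (√(n : ℝ) • β₀) (√(n : ℝ) • v)
          (√(n : ℝ) • (b - β₀))
        ≤ localCriterion (gram x n) (score x e n) (√(n : ℝ) • β₀) (√(n : ℝ) • v)
          (√(n : ℝ) • (b' - β₀)) := by
    intro b' hb'
    have := h.real_le hn hbot hv hb'
    rw [half_rss_add_penalty hn, half_rss_add_penalty hn] at this
    linarith
  set u : α ⊕ γ → ℝ := √(n : ℝ) • (b - β₀) with hu
  have hpos : ∀ w : α ⊕ γ → ℝ, 0 ≤ w ⬝ᵥ gram x n *ᵥ w := fun w =>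
    (mul_nonneg hκ.le (Finset.sum_nonneg fun j _ => sq_nonneg _)).trans (hG w)
  have huR : ∀ j, |u j| ≤ R := by
    have h1 := hmin β₀ (by
      rintro (j | j) hj
      · exact absurd hj (hfin j)
      · exact hβ j)
    rw [sub_self, smul_zero] at h1
    exact fun j => (abs_le_of_quad_le hκ (hG u) hW hM hδ
      (quad_le_of_localCriterion_le hB hvl hδ (fun j => hK0.trans (hvr j)) h1) j).trans hR
  have hu0 : ∀ j, u (Sum.inr j) = 0 := by
    refine inr_eq_zero_of_localCriterion_le (gram_isSymm x n) hpos hg hW huR hB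
      (fun j => hK.trans_le (hvr j)) ?_
    have h1 := hmin (Sum.elim (fun j => b (Sum.inl j)) 0) (by
      rintro (j | j) hj
      · exact absurd hj (hfin j)
      · rfl)
    convert h1 using 2
    ext j
    rcases j with j | j <;> simp [hu, hβ]
  have hb0 : ∀ j, b (Sum.inr j) = 0 := by
    intro j
    have h1 := hu0 j
    simpa [hu, hβ, hsn.ne', hn.ne'] using h1
  refine ⟨hb0, huR, fun j => ?_⟩
  refine abs_gradient_le_of_localCriterion_le (B := √(n : ℝ) • β₀) (gram_isSymm x n) (hvl j) fun t => ?_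
  have h1 := hmin (b + Pi.single (Sum.inl j) (t / √(n : ℝ))) (by
      rintro (i | i) hi
      · exact absurd hi (hfin i)
      · simp [hb0])
  convert h1 using 2
  ext i
  rcases eq_or_ne i (Sum.inl j) with rfl | hi
  · simp [hu]
    field_simp
    ring
  · simp [hu, hi]

theorem abs_nonsing_inv_mulVec_sub_le {ι : Type*} [Fintype ι] [DecidableEq ι] {A : Matrix ι ι ℝ}
    (hA : IsUnit A.det) {u w : ι → ℝ} {L τ : ℝ} (hL : ∀ i j, |A⁻¹ i j| ≤ L)
    (h : ∀ j, |(A *ᵥ u - w) j| ≤ τ) (j : ι) :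
    |u j - (A⁻¹ *ᵥ w) j| ≤ Fintype.card ι * (L * τ) := by
  have h1 : u - A⁻¹ *ᵥ w = A⁻¹ *ᵥ (A *ᵥ u - w) := by
    rw [mulVec_sub, mulVec_mulVec, nonsing_inv_mul _ hA, one_mulVec]
  have h2 := abs_mulVec_le hL h j
  rwa [← h1] at h2

theorem exists_abs_entry_le {ι κ : Type*} [Fintype ι] [Fintype κ] (A : Matrix ι κ ℝ) :
    ∃ L : ℝ, 0 ≤ L ∧ ∀ i j, |A i j| ≤ L := by
  refine ⟨∑ i, ∑ j, |A i j|, by positivity, fun i j => ?_⟩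
  refine (Finset.single_le_sum (f := fun j => |A i j|) (fun _ _ => abs_nonneg _)
    (Finset.mem_univ j)).trans ?_
  exact Finset.single_le_sum (f := fun i => ∑ j, |A i j|)
    (fun _ _ => Finset.sum_nonneg fun _ _ => abs_nonneg _) (Finset.mem_univ i)

/-- Weights near the origin dominate `n^{-1/2}`. -/
def PenalizesZero (pen : ℕ → ℝ → ℝ) : Prop :=
  ∀ M K : ℝ, 0 < M → 0 < K → ∀ᶠ n : ℕ in atTop, ∀ θ : ℝ, 0 ≤ θ → θ ≤ M / √(n : ℝ) →
    ((K / √(n : ℝ) : ℝ) : EReal) ≤ penaltyDeriv (pen n) θ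

/-- Weights away from the origin are negligible with respect to `n^{-1/2}`. -/
def SparesNonzero (pen : ℕ → ℝ → ℝ) : Prop :=
  ∀ θ₀ δ : ℝ, 0 < θ₀ → 0 < δ → ∃ ρ : ℝ, 0 < ρ ∧ ∀ᶠ n : ℕ in atTop, ∀ θ : ℝ, |θ - θ₀| ≤ ρ →
    √(n : ℝ) * |deriv (pen n) θ| ≤ δ

theorem posDef_toBlocks₁₁ {α γ : Type*} [Fintype α] [Fintype γ]
    {C : Matrix (α ⊕ γ) (α ⊕ γ) ℝ} (hC : C.PosDef) : C.toBlocks₁₁.PosDef :=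
  hC.submatrix Sum.inl_injective

theorem tendsto_const_div_sqrt (c : ℝ) :
    Tendsto (fun n : ℕ => c / √(n : ℝ)) atTop (𝓝 0) :=
  (Real.tendsto_sqrt_atTop.comp tendsto_natCast_atTop_atTop).const_div_atTop c

theorem eventually_oneStep_oracle {α γ : Type*} [Fintype α] [DecidableEq α] [Fintype γ]
    {x : ℕ → α ⊕ γ → ℝ} {C : Matrix (α ⊕ γ) (α ⊕ γ) ℝ} (hC : C.PosDef)
    (hdesign : Tendsto (gram x) atTop (𝓝 C))
    {β₀ : α ⊕ γ → ℝ} (hl : ∀ j, β₀ (Sum.inl j) ≠ 0) (hr : ∀ j, β₀ (Sum.inr j) = 0)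
    {pen : ℕ → ℝ → ℝ} (hzero : PenalizesZero pen) (hnonzero : SparesNonzero pen)
    {M τ : ℝ} (hM : 0 < M) (hτ : 0 < τ) :
    ∀ᶠ n : ℕ in atTop, ∀ (e : ℕ → ℝ) (b₀ b : α ⊕ γ → ℝ),
      (∀ j, |score x e n j| ≤ M) →
      IsOLS (design x n) (response x β₀ e n) b₀ →
      IsOneStep (pen n) (design x n) (response x β₀ e n) b₀ b →
      (∀ j, b (Sum.inr j) = 0) ∧
      ∀ j, |√(n : ℝ) * (b (Sum.inl j) - β₀ (Sum.inl j))
        - (C.toBlocks₁₁⁻¹ *ᵥ fun j => score x e n (Sum.inl j)) j| ≤ τ := by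
  obtain ⟨κ, hκ, hG⟩ := eventually_sum_sq_le_quadForm hC hdesign
  obtain ⟨g, hg0, hg⟩ := exists_abs_entry_le C
  obtain ⟨L, hL0, hL⟩ := exists_abs_entry_le C.toBlocks₁₁⁻¹
  set N : ℝ := (Fintype.card (α ⊕ γ) : ℝ) with hN
  set m : ℝ := (Fintype.card α : ℝ) with hm
  set R : ℝ := √N * (2 * (M + 1) / κ) + 1 with hRdef
  have hR : 0 < R := by positivity
  set A : ℝ := m * (L * (1 + m * R)) + 1 with hAdef
  have hA : 0 < A := by positivity
  set δ : ℝ := min 1 (τ / A) with hδdef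
  have hδ : 0 < δ := by positivity
  have hδ1 : δ ≤ 1 := min_le_left _ _
  have hδ2 : δ * A ≤ τ := by
    rw [← le_div_iff₀ hA]
    exact min_le_right _ _
  set K : ℝ := N * ((g + 1) * R) + M + 1 with hKdef
  have hK : 0 < K := by positivity
  choose ρ hρ hρn using fun j => hnonzero |β₀ (Sum.inl j)| δ (abs_pos.mpr (hl j)) hδ
  have hent : ∀ᶠ n in atTop, ∀ i j, |(gram x n - C) i j| ≤ δ := by
    refine eventually_all.mpr fun i => eventually_all.mpr fun j => ?_
    have h1 : Tendsto (fun n => (gram x n - C) i j) atTop (𝓝 0) := by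
      simpa using ((tendsto_pi_nhds.mp (tendsto_pi_nhds.mp hdesign i) j).sub_const (C i j))
    have h2 := h1.abs
    rw [abs_zero] at h2
    exact h2.eventually_le_const hδ
  have hρ1 : ∀ᶠ n : ℕ in atTop, ∀ j, R / √(n : ℝ) ≤ ρ j := eventually_all.mpr fun j =>
    (tendsto_const_div_sqrt R).eventually_le_const (hρ j)
  have hρ2 : ∀ᶠ n : ℕ in atTop, ∀ j, R / √(n : ℝ) < |β₀ (Sum.inl j)| := eventually_all.mpr fun j =>
    (tendsto_const_div_sqrt R).eventually_lt_const (abs_pos.mpr (hl j))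
  filter_upwards [hG, hent, hρ1, hρ2, eventually_all.mpr hρn, hzero R K hR hK, eventually_gt_atTop 0]
    with n hG hent hρ1 hρ2 hρn hzero hn e b₀ b hW hols hone
  have hsn : 0 < √(n : ℝ) := Real.sqrt_pos.mpr (by exact_mod_cast hn)
  have hgn : ∀ i j, |gram x n i j| ≤ g + 1 := by
    intro i j
    have h1 : gram x n i j = C i j + (gram x n - C) i j := by simp
    rw [h1]
    exact (abs_add_le _ _).trans (add_le_add (hg i j) ((hent i j).trans hδ1))
  have hRb : ∀ δ', δ' ≤ 1 → √N * (2 * (M + δ') / κ) ≤ R := by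
    intro δ' h
    have : √N * (2 * (M + δ') / κ) ≤ √N * (2 * (M + 1) / κ) := by gcongr
    linarith
  have hb₀ : ∀ j, |b₀ j - β₀ j| ≤ R / √(n : ℝ) := by
    intro j
    have h1 := (abs_le_of_quad_le hκ (hG _) hW hM.le le_rfl
      (by simpa using hols.quad_nonpos hn) j).trans (hRb 0 zero_le_one)
    rw [Pi.smul_apply, smul_eq_mul, abs_mul, abs_of_pos hsn] at h1
    rwa [le_div_iff₀ hsn, mul_comm]
  obtain ⟨h1, h2, h3⟩ := hone.oracle (K := K) (R := R) (δ := δ) hn hκ hM.le hδ.le (hRb δ hδ1) hG hgn hW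
    hr (fun j => by
      have h1 : |(|b₀ (Sum.inl j)| - |β₀ (Sum.inl j)|)| ≤ R / √(n : ℝ) :=
        (abs_abs_sub_abs_le _ _).trans (hb₀ _)
      refine ⟨deriv (pen n) |b₀ (Sum.inl j)|, ?_, hρn j _ (h1.trans (hρ1 j))⟩
      rw [penaltyDeriv, if_pos]
      have := (abs_le.mp h1).1
      linarith [hρ2 j]) (by rw [hKdef]; linarith) hK.le
    (fun j => hzero _ (abs_nonneg _) (by simpa [hr] using hb₀ (Sum.inr j)))
  refine ⟨h1, fun j => ?_⟩
  set u : α → ℝ := fun j => √(n : ℝ) * (b (Sum.inl j) - β₀ (Sum.inl j)) with hu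
  have huR : ∀ j, |u j| ≤ R := fun j => h2 _
  have h4 : ∀ j, |(C.toBlocks₁₁ *ᵥ u - fun j => score x e n (Sum.inl j)) j| ≤ δ * (1 + m * R) := by
    intro j
    have h5 : (gram x n *ᵥ (√(n : ℝ) • (b - β₀))) (Sum.inl j)
        = ((gram x n).toBlocks₁₁ *ᵥ u) j := by
      simp [mulVec, dotProduct, Fintype.sum_sum_type, h1, hr, hu, toBlocks₁₁]
    have h6 : |((gram x n - C).toBlocks₁₁ *ᵥ u) j| ≤ m * (δ * R) :=
      abs_mulVec_le (fun i k => hent _ _) huR j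
    have h7 : (gram x n - C).toBlocks₁₁ *ᵥ u = (gram x n).toBlocks₁₁ *ᵥ u - C.toBlocks₁₁ *ᵥ u := by
      rw [← sub_mulVec]
      rfl
    have h8 := h3 j
    rw [Pi.sub_apply, h5] at h8
    rw [h7, Pi.sub_apply] at h6
    rw [Pi.sub_apply]
    have h9 := abs_sub_le ((C.toBlocks₁₁ *ᵥ u) j) (((gram x n).toBlocks₁₁ *ᵥ u) j)
      (score x e n (Sum.inl j))
    rw [abs_sub_comm ((C.toBlocks₁₁ *ᵥ u) j) (((gram x n).toBlocks₁₁ *ᵥ u) j)] at h9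
    linarith
  have hunit : IsUnit C.toBlocks₁₁.det := (posDef_toBlocks₁₁ hC).det_pos.ne'.isUnit
  refine (abs_nonsing_inv_mulVec_sub_le hunit hL h4 j).trans (le_trans ?_ hδ2)
  rw [hAdef]
  linarith

section Limit

theorem norm_prod_sub_prod_le {ι : Type*} (s : Finset ι) (f g : ι → ℂ) (hf : ∀ i, ‖f i‖ ≤ 1)
    (hg : ∀ i, ‖g i‖ ≤ 1) : ‖∏ i ∈ s, f i - ∏ i ∈ s, g i‖ ≤ ∑ i ∈ s, ‖f i - g i‖ := by
  classical
  induction s using Finset.induction_on with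
  | empty => simp
  | insert a s ha ih =>
    rw [Finset.prod_insert ha, Finset.prod_insert ha, Finset.sum_insert ha]
    have hp : ‖∏ i ∈ s, g i‖ ≤ 1 := by
      rw [norm_prod]
      exact Finset.prod_le_one (fun _ _ => norm_nonneg _) fun i _ => hg i
    calc ‖f a * ∏ i ∈ s, f i - g a * ∏ i ∈ s, g i‖
        = ‖f a * (∏ i ∈ s, f i - ∏ i ∈ s, g i) + (f a - g a) * ∏ i ∈ s, g i‖ := by
          congr 1
          ring
      _ ≤ ‖f a‖ * ‖∏ i ∈ s, f i - ∏ i ∈ s, g i‖ + ‖f a - g a‖ * ‖∏ i ∈ s, g i‖ := by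
          refine (norm_add_le _ _).trans ?_
          rw [norm_mul, norm_mul]
      _ ≤ 1 * ‖∏ i ∈ s, f i - ∏ i ∈ s, g i‖ + ‖f a - g a‖ * 1 := by
          gcongr
          exact hf a
      _ ≤ _ := by linarith

theorem exp_sub_isLittleO (v : ℝ) :
    (fun t : ℝ => Complex.exp (-(v * t ^ 2 / 2)) - (1 - v * t ^ 2 / 2)) =o[𝓝 0]
      fun t : ℝ => t ^ 2 := by
  have h0 : Tendsto (fun t : ℝ => v / 2 * t ^ 2) (𝓝 0) (𝓝 0) := by
    have : Continuous fun t : ℝ => v / 2 * t ^ 2 := by fun_prop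
    simpa using this.tendsto 0
  have h1 : (fun t : ℝ => Complex.exp (-(v * t ^ 2 / 2)) - (1 - v * t ^ 2 / 2)) =O[𝓝 0]
      fun t : ℝ => (v / 2 * t ^ 2) ^ 2 := by
    refine Asymptotics.IsBigO.of_bound 1 ?_
    have habs := h0.abs
    rw [abs_zero] at habs
    filter_upwards [habs.eventually_le_const one_pos] with t ht
    have hn : ‖(-(v * t ^ 2 / 2) : ℂ)‖ = |v / 2 * t ^ 2| := by
      rw [norm_neg, ← Real.norm_eq_abs, ← Complex.norm_real]
      congr 1
      push_cast
      ring
    have h2 := Complex.norm_exp_sub_one_sub_id_le (x := -(v * t ^ 2 / 2)) (by rw [hn]; exact ht)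
    rw [hn, sq_abs] at h2
    rw [one_mul, Real.norm_eq_abs, abs_of_nonneg (sq_nonneg _)]
    convert h2 using 2
    ring
  refine h1.trans_isLittleO ?_
  have h3 : (fun t : ℝ => v / 2 * t ^ 2) =o[𝓝 0] fun _ : ℝ => (1 : ℝ) :=
    (Asymptotics.isLittleO_one_iff ℝ).mpr h0
  have h4 : (fun t : ℝ => v / 2 * t ^ 2) =O[𝓝 0] fun t : ℝ => t ^ 2 :=
    Asymptotics.isBigO_const_mul_self _ _ _
  simpa [sq] using h3.mul_isBigO h4

/-- Products of a function that agrees with a Gaussian characteristic function to second order,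
along an infinitesimal triangular array. -/
theorem tendsto_prod_exp {f : ℝ → ℂ} {v V : ℝ} (hv : 0 ≤ v) (hf1 : ∀ t, ‖f t‖ ≤ 1)
    (hf : (fun t : ℝ => f t - (1 - v * t ^ 2 / 2)) =o[𝓝 0] fun t : ℝ => t ^ 2)
    {c : (n : ℕ) → Fin n → ℝ} (hV : Tendsto (fun n => ∑ i, c n i ^ 2) atTop (𝓝 V))
    (hmax : ∀ η : ℝ, 0 < η → ∀ᶠ n in atTop, ∀ i, |c n i| ≤ η) :
    Tendsto (fun n => ∏ i, f (c n i)) atTop (𝓝 (Complex.exp (-(v * V / 2)))) := by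
  set g : ℝ → ℂ := fun t => Complex.exp (-(v * t ^ 2 / 2)) with hg
  have hg1 : ∀ t, ‖g t‖ ≤ 1 := by
    intro t
    have : g t = Complex.exp ((-(v * t ^ 2 / 2) : ℝ) : ℂ) := by simp [hg]
    rw [this, Complex.norm_exp_ofReal, Real.exp_le_one_iff]
    have : 0 ≤ v * t ^ 2 / 2 := by positivity
    linarith
  have hfg : (fun t : ℝ => f t - g t) =o[𝓝 0] fun t : ℝ => t ^ 2 := by
    simpa [hg] using hf.sub (exp_sub_isLittleO v)
  have hgprod : Tendsto (fun n => ∏ i, g (c n i)) atTop (𝓝 (Complex.exp (-(v * V / 2)))) := by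
    have h1 : ∀ n, ∏ i, g (c n i) = Complex.exp (-(v * (∑ i, c n i ^ 2 : ℝ) / 2)) := by
      intro n
      simp only [hg]
      rw [← Complex.exp_sum]
      congr 1
      push_cast
      rw [Finset.mul_sum, Finset.sum_div, Finset.sum_neg_distrib]
    simp only [h1]
    have hcont : Continuous fun r : ℝ => Complex.exp (-(v * (r : ℂ) / 2)) := by fun_prop
    exact (hcont.tendsto V).comp hV
  have hdiff : Tendsto (fun n => ∏ i, f (c n i) - ∏ i, g (c n i)) atTop (𝓝 0) := by
    rw [Metric.tendsto_nhds]
    intro η hη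
    have hη' : 0 < η / (2 * (|V| + 1)) := by positivity
    have h2 := hfg.def hη'
    obtain ⟨ρ, hρ, hρf⟩ := Metric.eventually_nhds_iff.mp h2
    filter_upwards [hmax (ρ / 2) (by positivity),
      hV.eventually_le_const (lt_of_le_of_lt (le_abs_self V) (lt_add_one |V|))] with n hn hVn
    rw [dist_zero_right]
    calc ‖∏ i, f (c n i) - ∏ i, g (c n i)‖
        ≤ ∑ i, ‖f (c n i) - g (c n i)‖ :=
          norm_prod_sub_prod_le _ _ _ (fun i => hf1 _) fun i => hg1 _
      _ ≤ ∑ i, η / (2 * (|V| + 1)) * c n i ^ 2 := by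
          refine Finset.sum_le_sum fun i _ => ?_
          have := hρf (y := c n i) (by rw [Real.dist_eq, sub_zero]; linarith [hn i])
          rwa [Real.norm_eq_abs, abs_of_nonneg (sq_nonneg (c n i))] at this
      _ = η / (2 * (|V| + 1)) * ∑ i, c n i ^ 2 := by rw [Finset.mul_sum]
      _ ≤ η / (2 * (|V| + 1)) * (|V| + 1) := by gcongr
      _ = η / 2 := by field_simp
      _ < η := by linarith
  simpa using hdiff.add hgprod

/-- If the averages of `z i ^ 2` converge, then the terms `z i / √n`, `i < n`, are uniformly
negligible. -/
theorem eventually_abs_div_sqrt_le {z : ℕ → ℝ} {V : ℝ}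
    (h : Tendsto (fun n : ℕ => (n : ℝ)⁻¹ * ∑ i ∈ Finset.range n, z i ^ 2) atTop (𝓝 V))
    {η : ℝ} (hη : 0 < η) :
    ∀ᶠ n : ℕ in atTop, ∀ i : Fin n, |(√(n : ℝ))⁻¹ * z i| ≤ η := by
  have h1 : Tendsto (fun n : ℕ => z n ^ 2 / (n + 1 : ℝ)) atTop (𝓝 0) := by
    have h2 := h.comp (tendsto_add_atTop_nat 1)
    have h3 := h.mul (tendsto_natCast_div_add_atTop (1 : ℝ))
    have h4 := h2.sub h3
    rw [mul_one, sub_self] at h4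
    refine h4.congr' ?_
    filter_upwards [eventually_gt_atTop 0] with n hn
    have hn' : (n : ℝ) ≠ 0 := by exact_mod_cast hn.ne'
    have hn1 : (n : ℝ) + 1 ≠ 0 := by positivity
    simp only [Function.comp_apply, Finset.sum_range_succ]
    push_cast
    field_simp
    ring
  have hη2 : 0 < η ^ 2 := by positivity
  obtain ⟨N, hN⟩ := eventually_atTop.mp (h1.eventually_le_const hη2)
  have h5 : Tendsto (fun n : ℕ => η ^ 2 * (n : ℝ)) atTop atTop :=
    tendsto_natCast_atTop_atTop.const_mul_atTop hη2
  filter_upwards [h5.eventually_ge_atTop (∑ i ∈ Finset.range N, z i ^ 2), eventually_gt_atTop 0]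
    with n hn hn0 i
  have hn0' : (0 : ℝ) < n := by exact_mod_cast hn0
  have hz : z i ^ 2 ≤ η ^ 2 * n := by
    rcases lt_or_ge (i : ℕ) N with hi | hi
    · exact (Finset.single_le_sum (f := fun i => z i ^ 2) (fun _ _ => sq_nonneg _)
        (Finset.mem_range.mpr hi)).trans hn
    · have h6 := hN i hi
      rw [div_le_iff₀ (by positivity)] at h6
      refine h6.trans ?_
      gcongr
      exact_mod_cast i.2
  refine abs_le_of_sq_le_sq ?_ hη.le
  rw [mul_pow, inv_pow, Real.sq_sqrt hn0'.le, inv_mul_le_iff₀ hn0']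
  linarith

end Limit

section Noise

variable {Ω : Type*} [MeasurableSpace Ω] {P : Measure Ω}

theorem charFun_map_isLittleO [IsProbabilityMeasure P] {X : Ω → ℝ} {σ : ℝ} (hX : MemLp X 2 P) (hmean : ∫ ω, X ω ∂P = 0)
    (hvar : variance X P = σ ^ 2) :
    (fun t : ℝ => charFun (P.map X) t - (1 - (σ ^ 2 : ℝ) * t ^ 2 / 2)) =o[𝓝 0]
      fun t : ℝ => t ^ 2 := by
  have hm : AEMeasurable X P := hX.aestronglyMeasurable.aemeasurable
  have hid : MemLp id 2 (P.map X) :=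
    (memLp_map_measure_iff (by fun_prop) hm).mpr (by simpa using hX)
  have hsq : ∫ ω, (X ^ 2) ω ∂P = σ ^ 2 := by
    rw [← hvar, variance_of_integral_eq_zero hm hmean]
    rfl
  have h1 := taylor_isLittleO_univ (x₀ := (0 : ℝ)) (n := 2) (contDiff_charFun (n := 2) hid)
  simp_rw [taylorWithinEval_charFun_two_zero hm hid, hmean, hsq] at h1
  simpa using h1

variable {ε : ℕ → Ω → ℝ} {σ : ℝ}

theorem charFun_weighted_sum (hindep : iIndepFun ε P) (hident : ∀ i, IdentDistrib (ε i) (ε 0) P P)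
    {n : ℕ} (c : Fin n → ℝ) :
    charFun (P.map fun ω => ∑ i : Fin n, c i * ε i ω) 1 = ∏ i, charFun (P.map (ε 0)) (c i) := by
  have hm : ∀ i, AEMeasurable (ε i) P := fun i => (hident i).aemeasurable_fst
  have h1 : iIndepFun (fun (i : Fin n) ω => c i * ε i ω) P :=
    (hindep.precomp Fin.val_injective).comp (fun i y => c i * y) fun i => by fun_prop
  rw [h1.charFun_map_fun_sum_eq_prod fun i : Fin n => (hm i).const_mul (c i), Finset.prod_apply]
  refine Finset.prod_congr rfl fun i _ => ?_
  rw [charFun_map_mul_comp (hm i), mul_one, (hident i).map_eq]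

theorem variance_weighted_sum (hindep : iIndepFun ε P)
    (hident : ∀ i, IdentDistrib (ε i) (ε 0) P P) (hL2 : MemLp (ε 0) 2 P)
    (hvar : variance (ε 0) P = σ ^ 2) {n : ℕ} (c : Fin n → ℝ) :
    variance (fun ω => ∑ i : Fin n, c i * ε i ω) P = σ ^ 2 * ∑ i, c i ^ 2 := by
  have h1 : iIndepFun (fun (i : Fin n) ω => c i * ε i ω) P :=
    (hindep.precomp Fin.val_injective).comp (fun i y => c i * y) fun i => by fun_prop
  have h2 : (fun ω => ∑ i : Fin n, c i * ε i ω) = ∑ i : Fin n, fun ω => c i * ε i ω := by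
    ext ω
    simp
  rw [h2, IndepFun.variance_sum (fun (i : Fin n) _ => ((hident i).memLp_iff.mpr hL2).const_mul (c i))
    fun i _ j _ hij => h1.indepFun hij, Finset.mul_sum]
  refine Finset.sum_congr rfl fun i _ => ?_
  rw [variance_const_mul, (hident i).variance_eq, hvar, mul_comm]

variable {ι : Type*} [Fintype ι] {x : ℕ → ι → ℝ}

theorem dotProduct_score_eq_sum (a : ι → ℝ) (e : ℕ → ℝ) (n : ℕ) :
    a ⬝ᵥ score x e n = ∑ i : Fin n, ((√(n : ℝ))⁻¹ * (x i ⬝ᵥ a)) * e i := by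
  rw [dotProduct_score, Finset.mul_sum]
  refine Finset.sum_congr rfl fun i _ => ?_
  rw [mul_assoc]
  rfl

theorem sum_sq_weights (a : ι → ℝ) (n : ℕ) :
    ∑ i : Fin n, ((√(n : ℝ))⁻¹ * (x i ⬝ᵥ a)) ^ 2 = a ⬝ᵥ gram x n *ᵥ a := by
  rw [dotProduct_gram_mulVec, Finset.mul_sum]
  refine Finset.sum_congr rfl fun i _ => ?_
  rw [mul_pow, inv_pow, Real.sq_sqrt (Nat.cast_nonneg _)]
  rfl

theorem aemeasurable_dotProduct_score (hident : ∀ i, IdentDistrib (ε i) (ε 0) P P) (a : ι → ℝ)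
    (n : ℕ) : AEMeasurable (fun ω => a ⬝ᵥ score x (fun i => ε i ω) n) P := by
  simp only [dotProduct_score_eq_sum]
  exact Finset.aemeasurable_fun_sum _ fun i _ => (hident i).aemeasurable_fst.const_mul _

theorem score_apply_eq_dotProduct [DecidableEq ι] (e : ℕ → ℝ) (n : ℕ) (j : ι) :
    score x e n j = Pi.single j 1 ⬝ᵥ score x e n := by
  simp

theorem aemeasurable_score (hident : ∀ i, IdentDistrib (ε i) (ε 0) P P) (n : ℕ) (j : ι) :
    AEMeasurable (fun ω => score x (fun i => ε i ω) n j) P := by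
  classical
  simp only [score_apply_eq_dotProduct (x := x) _ n j]
  exact aemeasurable_dotProduct_score hident _ _

theorem tendsto_dotProduct_gram {C : Matrix ι ι ℝ} (hG : Tendsto (gram x) atTop (𝓝 C))
    (a : ι → ℝ) : Tendsto (fun n => a ⬝ᵥ gram x n *ᵥ a) atTop (𝓝 (a ⬝ᵥ C *ᵥ a)) := by
  have : Continuous fun G : Matrix ι ι ℝ => a ⬝ᵥ G *ᵥ a := by fun_prop
  exact (this.tendsto C).comp hG

/-- A central limit theorem for linear forms of the score, in terms of characteristic functions. -/
theorem tendsto_charFun_score [IsProbabilityMeasure P] (hindep : iIndepFun ε P)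
    (hident : ∀ i, IdentDistrib (ε i) (ε 0) P P) (hL2 : MemLp (ε 0) 2 P)
    (hmean : ∫ ω, ε 0 ω ∂P = 0) (hvar : variance (ε 0) P = σ ^ 2) {C : Matrix ι ι ℝ}
    (hG : Tendsto (gram x) atTop (𝓝 C)) (a : ι → ℝ) :
    Tendsto (fun n => charFun (P.map fun ω => a ⬝ᵥ score x (fun i => ε i ω) n) 1) atTop
      (𝓝 (Complex.exp (-((σ ^ 2 : ℝ) * (a ⬝ᵥ C *ᵥ a : ℝ) / 2)))) := by
  have := Measure.isProbabilityMeasure_map (μ := P) hL2.aestronglyMeasurable.aemeasurable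
  simp only [dotProduct_score_eq_sum, charFun_weighted_sum hindep hident]
  have hV := tendsto_dotProduct_gram hG a
  refine tendsto_prod_exp (sq_nonneg σ) (fun t => norm_charFun_le_one t)
    (charFun_map_isLittleO hL2 hmean hvar) ?_ ?_
  · simpa only [sum_sq_weights] using hV
  · intro η hη
    refine eventually_abs_div_sqrt_le (z := fun i => x i ⬝ᵥ a) (V := a ⬝ᵥ C *ᵥ a) ?_ hη
    refine hV.congr fun n => ?_
    rw [dotProduct_gram_mulVec, Finset.sum_range]
    rfl

theorem measure_lt_abs_score_le [IsProbabilityMeasure P] (hindep : iIndepFun ε P)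
    (hident : ∀ i, IdentDistrib (ε i) (ε 0) P P) (hL2 : MemLp (ε 0) 2 P)
    (hmean : ∫ ω, ε 0 ω ∂P = 0) (hvar : variance (ε 0) P = σ ^ 2) (n : ℕ) (j : ι)
    {M : ℝ} (hM : 0 < M) :
    P {ω | M < |score x (fun i => ε i ω) n j|} ≤ ENNReal.ofReal (σ ^ 2 * gram x n j j / M ^ 2) := by
  classical
  have hS : (fun ω => score x (fun i => ε i ω) n j)
      = fun ω => ∑ i : Fin n, ((√(n : ℝ))⁻¹ * (x i ⬝ᵥ Pi.single j 1)) * ε i ω := by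
    ext ω
    rw [score_apply_eq_dotProduct, dotProduct_score_eq_sum]
  have hLp : MemLp (fun ω => score x (fun i => ε i ω) n j) 2 P := by
    rw [hS]
    exact memLp_finsetSum _ fun i _ => ((hident i).memLp_iff.mpr hL2).const_mul _
  have hm0 : ∫ ω, score x (fun i => ε i ω) n j ∂P = 0 := by
    rw [hS, integral_finsetSum _ fun (i : Fin n) _ =>
      (((hident i).memLp_iff.mpr hL2).integrable one_le_two).const_mul _]
    refine Finset.sum_eq_zero fun i _ => ?_
    rw [integral_const_mul, (hident i).integral_eq, hmean, mul_zero]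
  have hv : variance (fun ω => score x (fun i => ε i ω) n j) P = σ ^ 2 * gram x n j j := by
    rw [hS, variance_weighted_sum hindep hident hL2 hvar, sum_sq_weights]
    simp
  have h1 := meas_ge_le_variance_div_sq hLp hM
  rw [hm0, hv] at h1
  refine (measure_mono fun ω hω => ?_).trans h1
  simpa using le_of_lt hω

/-- Events that fail, for large `n`, only where the score is large have probability tending to
zero. -/
theorem tendsto_measure_zero_of_score [IsProbabilityMeasure P] (hindep : iIndepFun ε P)
    (hident : ∀ i, IdentDistrib (ε i) (ε 0) P P) (hL2 : MemLp (ε 0) 2 P)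
    (hmean : ∫ ω, ε 0 ω ∂P = 0) (hvar : variance (ε 0) P = σ ^ 2) {C : Matrix ι ι ℝ}
    (hG : Tendsto (gram x) atTop (𝓝 C)) {A : ℕ → Set Ω}
    (hA : ∀ M : ℝ, 0 < M → ∀ᶠ n in atTop, ∀ᵐ ω ∂P,
      (∀ j, |score x (fun i => ε i ω) n j| ≤ M) → ω ∉ A n) :
    Tendsto (fun n => P (A n)) atTop (𝓝 0) := by
  have hK : ∀ᶠ n in atTop, ∀ j, σ ^ 2 * gram x n j j ≤ σ ^ 2 * C j j + 1 := by
    refine eventually_all.mpr fun j => ?_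
    have h1 : Tendsto (fun n => gram x n j j) atTop (𝓝 (C j j)) :=
      tendsto_pi_nhds.mp (tendsto_pi_nhds.mp hG j) j
    exact (h1.const_mul (σ ^ 2)).eventually_le_const (lt_add_one _)
  have hbound : ∀ M : ℝ, 0 < M → ∀ᶠ n in atTop,
      P (A n) ≤ ∑ j, ENNReal.ofReal ((σ ^ 2 * C j j + 1) / M ^ 2) := by
    intro M hM
    filter_upwards [hA M hM, hK] with n hn hK
    have h1 : P (A n) ≤ P (⋃ j, {ω | M < |score x (fun i => ε i ω) n j|}) := by
      refine measure_mono_ae ?_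
      filter_upwards [hn] with ω hω hωA
      by_contra hnot
      refine hω (fun j => ?_) hωA
      by_contra hj
      exact hnot (Set.mem_iUnion.mpr ⟨j, not_le.mp hj⟩)
    refine h1.trans ((measure_iUnion_fintype_le _ _).trans (Finset.sum_le_sum fun j _ => ?_))
    refine (measure_lt_abs_score_le hindep hident hL2 hmean hvar n j hM).trans ?_
    exact ENNReal.ofReal_le_ofReal (div_le_div_of_nonneg_right (hK j) (by positivity))
  have hlim : Tendsto (fun M : ℝ => ∑ j, ENNReal.ofReal ((σ ^ 2 * C j j + 1) / M ^ 2)) atTop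
      (𝓝 0) := by
    have : Tendsto (fun M : ℝ => ∑ j, ENNReal.ofReal ((σ ^ 2 * C j j + 1) / M ^ 2)) atTop
        (𝓝 (∑ _j : ι, ENNReal.ofReal 0)) :=
      tendsto_finsetSum _ fun j _ => (ENNReal.continuous_ofReal.tendsto 0).comp
        ((tendsto_pow_atTop two_ne_zero).const_div_atTop _)
    simpa using this
  rw [ENNReal.tendsto_nhds_zero]
  intro η hη
  obtain ⟨M, hMη, hM⟩ := ((ENNReal.tendsto_nhds_zero.mp hlim η hη).and (eventually_gt_atTop 0)).exists
  filter_upwards [hbound M hM] with n hn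
  exact hn.trans hMη

end Noise

section CLT

variable {Ω : Type*} [MeasurableSpace Ω] {P : Measure Ω} [IsProbabilityMeasure P]
  {ε : ℕ → Ω → ℝ} {σ : ℝ}

/-- The central limit theorem for the leading term of the one-step estimator. -/
theorem tendstoInDistribution_inv_mulVec_score {α γ : Type*} [Fintype α] [DecidableEq α] [Fintype γ]
    (hindep : iIndepFun ε P)
    (hident : ∀ i, IdentDistrib (ε i) (ε 0) P P) (hL2 : MemLp (ε 0) 2 P)
    (hmean : ∫ ω, ε 0 ω ∂P = 0) (hvar : variance (ε 0) P = σ ^ 2)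
    {x : ℕ → α ⊕ γ → ℝ} {C : Matrix (α ⊕ γ) (α ⊕ γ) ℝ} (hC : C.PosDef)
    (hG : Tendsto (gram x) atTop (𝓝 C)) :
    TendstoInDistribution
      (fun (n : ℕ) (ω : Ω) => (WithLp.toLp 2
        (C.toBlocks₁₁⁻¹ *ᵥ fun j => score x (fun i => ε i ω) n (Sum.inl j)) : EuclideanSpace ℝ α))
      atTop (id : EuclideanSpace ℝ α → EuclideanSpace ℝ α) (fun _ => P)
      (multivariateGaussian 0 (σ ^ 2 • C.toBlocks₁₁⁻¹)) := by
  have hA := posDef_toBlocks₁₁ hC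
  set A := C.toBlocks₁₁ with hAdef
  have hunit : IsUnit A.det := hA.det_pos.ne'.isUnit
  have hsymm : (A⁻¹)ᵀ = A⁻¹ := by
    have := hA.inv.isHermitian.eq
    rwa [conjTranspose_eq_transpose_of_trivial] at this
  have hmeas : ∀ n, AEMeasurable (fun ω => (WithLp.toLp 2
      (A⁻¹ *ᵥ fun j => score x (fun i => ε i ω) n (Sum.inl j)) : EuclideanSpace ℝ α)) P := by
    intro n
    have h1 : AEMeasurable (fun ω => fun j : α => score x (fun i => ε i ω) n (Sum.inl j)) P :=
      aemeasurable_pi_lambda _ fun j => aemeasurable_score hident n _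
    have h2 : Continuous fun w : α → ℝ => (WithLp.toLp 2 (A⁻¹ *ᵥ w) : EuclideanSpace ℝ α) := by
      fun_prop
    exact h2.measurable.comp_aemeasurable h1
  refine ⟨hmeas, aemeasurable_id, ?_⟩
  refine ProbabilityMeasure.tendsto_iff_tendsto_charFun.mpr fun t => ?_
  set a : α ⊕ γ → ℝ := Sum.elim (A⁻¹ *ᵥ t.ofLp) 0 with ha
  have hpsd : (σ ^ 2 • A⁻¹).PosSemidef := hA.inv.posSemidef.smul (sq_nonneg σ)
  have hlim : charFun ((multivariateGaussian 0 (σ ^ 2 • A⁻¹)).map id) t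
      = Complex.exp (-((σ ^ 2 : ℝ) * (a ⬝ᵥ C *ᵥ a : ℝ) / 2)) := by
    rw [Measure.map_id, charFun_multivariateGaussian hpsd]
    have h1 : a ⬝ᵥ C *ᵥ a = t.ofLp ⬝ᵥ A⁻¹ *ᵥ t.ofLp := by
      have h2 : a ⬝ᵥ C *ᵥ a = (A⁻¹ *ᵥ t.ofLp) ⬝ᵥ A *ᵥ (A⁻¹ *ᵥ t.ofLp) := by
        simp [ha, hAdef, dotProduct, mulVec, Fintype.sum_sum_type, toBlocks₁₁]
      rw [h2, mulVec_mulVec, mul_nonsing_inv _ hunit, one_mulVec, dotProduct_comm]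
    rw [h1, smul_mulVec, dotProduct_smul, smul_eq_mul]
    congr 1
    simp
  have hpre : ∀ n, charFun (P.map fun ω => (WithLp.toLp 2
      (A⁻¹ *ᵥ fun j => score x (fun i => ε i ω) n (Sum.inl j)) : EuclideanSpace ℝ α)) t
      = charFun (P.map fun ω => a ⬝ᵥ score x (fun i => ε i ω) n) 1 := by
    intro n
    rw [charFun_apply, charFun_apply, integral_map (hmeas n) (by fun_prop),
      integral_map (aemeasurable_dotProduct_score hident a n) (by fun_prop)]
    refine integral_congr_ae (Eventually.of_forall fun ω => ?_)
    have h1 : inner ℝ (WithLp.toLp 2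
        (A⁻¹ *ᵥ fun j => score x (fun i => ε i ω) n (Sum.inl j)) : EuclideanSpace ℝ α) t
        = a ⬝ᵥ score x (fun i => ε i ω) n := by
      rw [EuclideanSpace.inner_eq_star_dotProduct]
      simp only [star_trivial]
      rw [dotProduct_mulVec, ← mulVec_transpose, hsymm]
      simp [ha, dotProduct, Fintype.sum_sum_type]
    simp only [h1]
    simp
  have := tendsto_charFun_score hindep hident hL2 hmean hvar hG a
  rw [← hlim] at this
  exact this.congr fun n => (hpre n).symm

end CLT

/-- The oracle properties of the one-step estimator, for penalties whose weights dominate `n^{-1/2}`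
near the origin and are negligible with respect to it away from the origin. -/
theorem oracleProperties_of_penalizesZero_of_sparesNonzero
    {Ω : Type*} [MeasurableSpace Ω] {P : Measure Ω} [IsProbabilityMeasure P]
    {q r : ℕ} {ε : ℕ → Ω → ℝ} {σ : ℝ}
    (hindep : iIndepFun ε P) (hident : ∀ i, IdentDistrib (ε i) (ε 0) P P)
    (hL2 : MemLp (ε 0) 2 P) (hmean : ∫ ω, ε 0 ω ∂P = 0) (hvar : variance (ε 0) P = σ ^ 2)
    {x : ℕ → Fin q ⊕ Fin r → ℝ} {C : Matrix (Fin q ⊕ Fin r) (Fin q ⊕ Fin r) ℝ}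
    (hC : C.PosDef) (hG : Tendsto (gram x) atTop (𝓝 C))
    {β₁₀ : Fin q → ℝ} (hβ : ∀ j, β₁₀ j ≠ 0)
    {β₀ : Fin q ⊕ Fin r → ℝ} (hβ₀ : β₀ = Sum.elim β₁₀ 0)
    {bols : ℕ → Ω → Fin q ⊕ Fin r → ℝ}
    (hols : ∀ᶠ n in atTop, ∀ᵐ ω ∂P,
      IsOLS (design x n) (response x β₀ (fun i => ε i ω) n) (bols n ω))
    {pen : ℕ → ℝ → ℝ} (hzero : PenalizesZero pen) (hnonzero : SparesNonzero pen)
    {b : ℕ → Ω → Fin q ⊕ Fin r → ℝ} (hb : ∀ n, AEMeasurable (b n) P)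
    (hone : ∀ᶠ n in atTop, ∀ᵐ ω ∂P,
      IsOneStep (pen n) (design x n) (response x β₀ (fun i => ε i ω) n) (bols n ω) (b n ω)) :
    OracleProperties P C σ β₁₀ b := by
  have key : ∀ M τ : ℝ, 0 < M → 0 < τ → ∀ᶠ n : ℕ in atTop, ∀ᵐ ω ∂P,
      (∀ j, |score x (fun i => ε i ω) n j| ≤ M) →
      (∀ j, b n ω (Sum.inr j) = 0) ∧
      ∀ j, |√(n : ℝ) * (b n ω (Sum.inl j) - β₁₀ j)
        - (C.toBlocks₁₁⁻¹ *ᵥ fun j => score x (fun i => ε i ω) n (Sum.inl j)) j| ≤ τ := by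
    intro M τ hM hτ
    filter_upwards [eventually_oneStep_oracle hC hG (β₀ := β₀) (by simpa [hβ₀] using hβ)
      (by simp [hβ₀]) hzero hnonzero hM hτ, hols, hone] with n hn h1 h2
    filter_upwards [h1, h2] with ω h1 h2 hW
    simpa [hβ₀] using hn _ _ _ hW h1 h2
  constructor
  · have h0 : Tendsto (fun n => P {ω | ∀ j : Fin r, b n ω (Sum.inr j) = 0}ᶜ) atTop (𝓝 0) := by
      refine tendsto_measure_zero_of_score hindep hident hL2 hmean hvar hG fun M hM => ?_
      filter_upwards [key M 1 hM one_pos] with n hn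
      filter_upwards [hn] with ω hω hW
      simpa using (hω hW).1
    have h1 : ∀ n, P {ω | ∀ j : Fin r, b n ω (Sum.inr j) = 0}
        = 1 - P {ω | ∀ j : Fin r, b n ω (Sum.inr j) = 0}ᶜ := by
      intro n
      have hS : MeasurableSet {v : Fin q ⊕ Fin r → ℝ | ∀ j : Fin r, v (Sum.inr j) = 0} := by
        measurability
      have hN : NullMeasurableSet {ω | ∀ j : Fin r, b n ω (Sum.inr j) = 0} P :=
        (hb n).nullMeasurableSet_preimage hS
      rw [prob_compl_eq_one_sub₀ hN, ENNReal.sub_sub_cancel ENNReal.one_ne_top prob_le_one]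
    simp only [h1]
    simpa using ENNReal.Tendsto.sub (tendsto_const_nhds (x := (1 : ENNReal))) h0
      (Or.inl ENNReal.one_ne_top)
  · refine tendstoInDistribution_of_tendstoInMeasure_sub _ _
      (tendstoInDistribution_inv_mulVec_score hindep hident hL2 hmean hvar hC hG) ?_ fun n => ?_
    · rw [tendstoInMeasure_iff_norm]
      intro η hη
      refine tendsto_measure_zero_of_score hindep hident hL2 hmean hvar hG fun M hM => ?_
      have hτ : 0 < η / (√q + 1) := by positivity
      filter_upwards [key M _ hM hτ] with n hn
      filter_upwards [hn] with ω hω hW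
      have h1 := (hω hW).2
      simp only [not_le, Pi.sub_apply, Pi.zero_apply, sub_zero]
      rw [EuclideanSpace.norm_eq]
      have h2 : ∑ j : Fin q, ‖((WithLp.toLp 2 fun j : Fin q =>
            √(n : ℝ) * (b n ω (Sum.inl j) - β₁₀ j) : EuclideanSpace ℝ (Fin q))
          - (WithLp.toLp 2 (C.toBlocks₁₁⁻¹ *ᵥ fun j => score x (fun i => ε i ω) n (Sum.inl j)) :
            EuclideanSpace ℝ (Fin q))).ofLp j‖ ^ 2 ≤ q * (η / (√q + 1)) ^ 2 := by
        refine (Finset.sum_le_card_nsmul Finset.univ _ ((η / (√q + 1)) ^ 2) fun j _ => ?_).trans ?_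
        · exact pow_le_pow_left₀ (norm_nonneg _) (h1 j) 2
        · simp
      refine (Real.sqrt_le_sqrt h2).trans_lt ?_
      rw [Real.sqrt_mul (Nat.cast_nonneg _), Real.sqrt_sq hτ.le]
      rw [← mul_div_assoc, div_lt_iff₀ (by positivity)]
      nlinarith
    · have h2 : Continuous fun v : Fin q ⊕ Fin r → ℝ =>
          (WithLp.toLp 2 fun j : Fin q => √(n : ℝ) * (v (Sum.inl j) - β₁₀ j) :
            EuclideanSpace ℝ (Fin q)) := by
        fun_prop
      exact h2.measurable.comp_aemeasurable (hb n)

theorem penalizesZero_scad {a : ℝ} (ha : 2 < a) {lam : ℕ → ℝ}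
    (h : Tendsto (fun n : ℕ => √(n : ℝ) * lam n) atTop atTop) :
    PenalizesZero fun n => scad a (lam n) := by
  intro M K hM hK
  filter_upwards [h.eventually_ge_atTop (max M K), eventually_gt_atTop 0] with n hn hn0 θ hθ hθM
  have hs : 0 < √(n : ℝ) := Real.sqrt_pos.mpr (by exact_mod_cast hn0)
  have hM' : M / √(n : ℝ) ≤ lam n := by
    rw [div_le_iff₀' hs]
    exact (le_max_left _ _).trans hn
  have hK' : K / √(n : ℝ) ≤ lam n := by
    rw [div_le_iff₀' hs]
    exact (le_max_right _ _).trans hn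
  have hl : 0 < lam n := (div_pos hM hs).trans_le hM'
  rw [penaltyDeriv_scad ha hl hθ, EReal.coe_le_coe_iff, scadDeriv, if_pos (hθM.trans hM')]
  exact hK'

theorem sparesNonzero_scad {a : ℝ} (ha : 2 < a) {lam : ℕ → ℝ}
    (h : Tendsto (fun n : ℕ => √(n : ℝ) * lam n) atTop atTop) (h0 : Tendsto lam atTop (𝓝 0)) :
    SparesNonzero fun n => scad a (lam n) := by
  intro θ₀ δ hθ₀ hδ
  refine ⟨θ₀ / 2, by positivity, ?_⟩
  have hd : 0 < θ₀ / (2 * a) := by positivity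
  filter_upwards [h.eventually_gt_atTop 0, h0.eventually_lt_const hd] with n hn hn' θ hθ
  have hl : 0 < lam n := pos_of_mul_pos_right hn (Real.sqrt_nonneg _)
  have h1 : θ₀ / 2 ≤ θ := by linarith [(abs_le.mp hθ).1]
  have h2 : a * lam n < θ₀ / 2 := by
    rw [lt_div_iff₀ (by positivity)] at hn'
    linarith
  have h3 : lam n < θ := by nlinarith
  rw [(hasDerivAt_scad ha hl θ).deriv, scadDeriv, if_neg (not_le.mpr h3), max_eq_right (by linarith)]
  simpa using hδ.le

theorem sparesNonzero_const_mul {p : ℝ → ℝ} {lam : ℕ → ℝ} (hp : ContinuousOn (deriv p) (Set.Ioi 0))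
    (h : Tendsto (fun n : ℕ => √(n : ℝ) * lam n) atTop (𝓝 0)) :
    SparesNonzero fun n θ => lam n * p θ := by
  intro θ₀ δ hθ₀ hδ
  have hc : ContinuousAt (deriv p) θ₀ := hp.continuousAt (Ioi_mem_nhds hθ₀)
  obtain ⟨ρ, hρ, hρb⟩ := Metric.continuousAt_iff.mp hc 1 one_pos
  refine ⟨ρ / 2, by positivity, ?_⟩
  have hpos : 0 < δ / (|deriv p θ₀| + 1) := by positivity
  have habs := h.abs
  rw [abs_zero] at habs
  filter_upwards [habs.eventually_lt_const hpos] with n hn θ hθ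
  have h1 := hρb (x := θ) (by rw [Real.dist_eq]; linarith)
  rw [Real.dist_eq] at h1
  have h2 : |deriv p θ| ≤ |deriv p θ₀| + 1 := by
    have := abs_sub_abs_le_abs_sub (deriv p θ) (deriv p θ₀)
    linarith
  rw [deriv_const_mul_field, abs_mul, ← mul_assoc]
  rw [abs_mul, abs_of_nonneg (Real.sqrt_nonneg _)] at hn
  rw [lt_div_iff₀ (by positivity)] at hn
  refine le_trans ?_ hn.le
  gcongr

theorem penalizesZero_const_mul {p : ℝ → ℝ} {s : ℝ} {lam : ℕ → ℝ} (hs : 0 < s)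
    (hp : ∃ c : ℝ, 0 < c ∧ ∀ᶠ θ : ℝ in 𝓝[>] (0 : ℝ), c * θ ^ (-s) ≤ deriv p θ)
    (h : Tendsto (fun n : ℕ => (n : ℝ) ^ ((1 + s) / 2) * lam n) atTop atTop) :
    PenalizesZero fun n θ => lam n * p θ := by
  intro M K hM hK
  obtain ⟨c, hc, hcp⟩ := hp
  obtain ⟨η, hη, hηp⟩ := (mem_nhdsGT_iff_exists_Ioo_subset (a := (0 : ℝ))).mp hcp
  have hMs : Tendsto (fun n : ℕ => M / √(n : ℝ)) atTop (𝓝 0) := tendsto_const_div_sqrt M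
  filter_upwards [h.eventually_ge_atTop (K * M ^ s / c), h.eventually_gt_atTop 0,
    hMs.eventually_lt_const (show (0 : ℝ) < η from hη), eventually_gt_atTop 0] with n hn hpos hnη hn0 θ hθ hθM
  have hn0' : (0 : ℝ) < n := by exact_mod_cast hn0
  have hsq : 0 < √(n : ℝ) := Real.sqrt_pos.mpr hn0'
  have hl : 0 < lam n := pos_of_mul_pos_right hpos (by positivity)
  have key : ∀ t : ℝ, 0 < t → t ≤ M / √(n : ℝ) → K / √(n : ℝ) ≤ deriv (fun θ => lam n * p θ) t := by
    intro t ht htM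
    rw [deriv_const_mul_field]
    have h1 : c * t ^ (-s) ≤ deriv p t := hηp ⟨ht, htM.trans_lt hnη⟩
    have h2 : (M / √(n : ℝ)) ^ (-s) ≤ t ^ (-s) :=
      Real.rpow_le_rpow_of_nonpos ht htM (by linarith)
    have h3 : (M / √(n : ℝ)) ^ (-s) = (n : ℝ) ^ (s / 2) / M ^ s := by
      rw [Real.rpow_neg (by positivity), Real.div_rpow hM.le hsq.le, inv_div, Real.sqrt_eq_rpow,
        ← Real.rpow_mul hn0'.le]
      congr 2
      ring
    have h4 : (n : ℝ) ^ ((1 + s) / 2) = √(n : ℝ) * (n : ℝ) ^ (s / 2) := by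
      rw [Real.sqrt_eq_rpow, ← Real.rpow_add hn0']
      congr 1
      ring
    rw [h4, div_le_iff₀ hc] at hn
    have hMs : 0 < M ^ s := Real.rpow_pos_of_pos hM s
    calc K / √(n : ℝ) = K * M ^ s / (√(n : ℝ) * M ^ s) := by field_simp
      _ ≤ √(n : ℝ) * (n : ℝ) ^ (s / 2) * lam n * c / (√(n : ℝ) * M ^ s) := by gcongr
      _ = lam n * (c * ((n : ℝ) ^ (s / 2) / M ^ s)) := by field_simp
      _ ≤ lam n * (c * t ^ (-s)) := by rw [← h3]; gcongr
      _ ≤ lam n * deriv p t := by gcongr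
  unfold penaltyDeriv
  split_ifs with hθ0
  · exact EReal.coe_le_coe_iff.mpr (key θ hθ0 hθM)
  · refine le_liminf_of_le (by isBoundedDefault) ?_
    have : 0 < M / √(n : ℝ) := by positivity
    filter_upwards [Ioo_mem_nhdsGT this] with t ht
    exact EReal.coe_le_coe_iff.mpr (key t ht.1 ht.2.le)

end OneStep

theorem theorem4 {Ω : Type*} [MeasurableSpace Ω] (P : Measure Ω) [IsProbabilityMeasure P]
    {q r : ℕ}
    -- i.i.d. errors with mean zero and variance `σ²`
    (ε : ℕ → Ω → ℝ) (σ : ℝ)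
    (hindep : iIndepFun ε P) (hident : ∀ i, IdentDistrib (ε i) (ε 0) P P)
    (hL2 : MemLp (ε 0) 2 P) (hmean : ∫ ω, ε 0 ω ∂P = 0) (hvar : variance (ε 0) P = σ ^ 2)
    -- the design: `Xᵀ X / n → C` with `C` positive definite
    (x : ℕ → Fin q ⊕ Fin r → ℝ) (C : Matrix (Fin q ⊕ Fin r) (Fin q ⊕ Fin r) ℝ)
    (hC : C.PosDef)
    (hdesign : Tendsto (fun n : ℕ => (n : ℝ)⁻¹ • ((OneStep.design x n)ᵀ * OneStep.design x n))
      atTop (𝓝 C))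
    -- the true coefficients `β₀ = (β₁₀, 0)`, all components of `β₁₀` being nonzero
    (β₁₀ : Fin q → ℝ) (hβ : ∀ j, β₁₀ j ≠ 0)
    (β₀ : Fin q ⊕ Fin r → ℝ) (hβ₀ : β₀ = Sum.elim β₁₀ 0)
    -- the initial value: ordinary least squares
    (bols : ℕ → Ω → Fin q ⊕ Fin r → ℝ)
    (hols : ∀ᶠ n in atTop, ∀ᵐ ω ∂P,
      OneStep.IsOLS (OneStep.design x n) (OneStep.response x β₀ (fun i => ε i ω) n) (bols n ω)) :
    -- the SCAD penalty
    (∀ (a : ℝ) (lam : ℕ → ℝ), 2 < a →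
      Tendsto (fun n : ℕ => √(n : ℝ) * lam n) atTop atTop →
      Tendsto lam atTop (𝓝 0) →
      ∀ b : ℕ → Ω → Fin q ⊕ Fin r → ℝ, (∀ n, AEMeasurable (b n) P) →
        (∀ᶠ n in atTop, ∀ᵐ ω ∂P,
          OneStep.IsOneStep (OneStep.scad a (lam n)) (OneStep.design x n)
            (OneStep.response x β₀ (fun i => ε i ω) n) (bols n ω) (b n ω)) →
        OneStep.OracleProperties P C σ β₁₀ b) ∧
    -- penalties `λₙ p` with `p'(θ)` of order `θ⁻ˢ` at the origin
    (∀ (p : ℝ → ℝ) (s : ℝ) (lam : ℕ → ℝ), 0 < s →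
      DifferentiableOn ℝ p (Set.Ioi 0) → ContinuousOn (deriv p) (Set.Ioi 0) →
      (deriv p =O[𝓝[>] (0 : ℝ)] fun θ : ℝ => θ ^ (-s)) →
      (∃ c : ℝ, 0 < c ∧ ∀ᶠ θ : ℝ in 𝓝[>] (0 : ℝ), c * θ ^ (-s) ≤ deriv p θ) →
      Tendsto (fun n : ℕ => (n : ℝ) ^ ((1 + s) / 2) * lam n) atTop atTop →
      Tendsto (fun n : ℕ => √(n : ℝ) * lam n) atTop (𝓝 0) →
      ∀ b : ℕ → Ω → Fin q ⊕ Fin r → ℝ, (∀ n, AEMeasurable (b n) P) →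
        (∀ᶠ n in atTop, ∀ᵐ ω ∂P,
          OneStep.IsOneStep (fun θ => lam n * p θ) (OneStep.design x n)
            (OneStep.response x β₀ (fun i => ε i ω) n) (bols n ω) (b n ω)) →
        OneStep.OracleProperties P C σ β₁₀ b) := by
  refine ⟨fun a lam ha h1 h2 b hb hone => ?_, fun p s lam hs _ hp _ hc h1 h2 b hb hone => ?_⟩
  · exact OneStep.oracleProperties_of_penalizesZero_of_sparesNonzero hindep hident hL2 hmean hvar hC
      hdesign hβ hβ₀ hols (OneStep.penalizesZero_scad ha h1) (OneStep.sparesNonzero_scad ha h1 h2)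
      hb hone
  · exact OneStep.oracleProperties_of_penalizesZero_of_sparesNonzero hindep hident hL2 hmean hvar hC
      hdesign hβ hβ₀ hols (OneStep.penalizesZero_const_mul hs hc h1)
      (OneStep.sparesNonzero_const_mul hp h2) hb hone
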